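/- **Setting.** Circuits are over the gate set $\{H,S,T,\mathrm{CNOT}\}$ and their gate complexity is the number of gates. Let $U_B=(H\otimes I)\,\mathrm{CNOT}$, and let $U_B^{\otimes n}$ act on $n$ pairs of qubits (first members in a front register, second members in a back register). A channel $\mathcal C$ on $1+n$ qubits with Kraus operators $|0\rangle\langle 0|\otimes K_i+|1\rangle\langle 1|\otimes L_i$, where $\sum_iK_i^\dagger K_i=\sum_iL_i^\dagger L_i=I$, *realizes* an $n$-qubit operator $V$ in Pauli quantum computing with efficiency $\eta>0$ if $\sum_i K_i\otimes L_i^*=\eta\,U_B^{\dagger\otimes n}(F_0\otimes V)U_B^{\otimes n}$ for some operator $F_0$ with $F_0|0\rangle^{\otimes n}=|0\rangle^{\otimes n}$. A unitary $W$ on $1+n+e$ qubits *purifies* $\mathcal C$ if $\mathcal C[\rho]=\mathrm{Tr}_{\mathrm{env}}\big(W(\rho\otimes|0\rangle\langle0|^{\otimes e})W^\dagger\big)$ for all $\rho$. A query to $\mathcal C$ is one application of $W$ or of $W^\dagger$; a query algorithm starts in the all-zero state of the $1+n+e$ qubits and some workspace qubits, alternates queries with fixed unitaries, and finally computes a real number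 from a computational-basis measurement. **Theorem (estimating $\langle +|^{\otimes n}U|0\rangle^{\otimes n}$).** For an $n$-qubit circuit $U$ over $\{H,S,T,\mathrm{CNOT}\}$ with exactly $k$ Hadamard gates put $V=H^{\otimes n}UH^{\otimes n}$. There are universal constants $c$ and $B>0$ such that the following hold. 1. For every $n$ and every $n$-qubit circuit $U$ with $g$ gates, $k$ of them Hadamard gates, there is a channel $\mathcal C_V$ of the above form that realizes $V$ with efficiency $\eta=2^{-k/2}$ and is purified by a circuit over $\{H,S,T,\mathrm{CNOT}\}$ with at most $cg$ gates and at most $cg$ environment qubits. 2. For all $n,k,e$ and all $\epsilon>0$ there are two query algorithms, one for the real part and one for the imaginary part, depending only on $(n,k,e,\epsilon)$ and each making at most $$B\,2^{-(n-k)/2}\,\epsilon^{-1}$$ queries, such that for every $n$-qubit circuit $U$ with $k$ Hadamard gates and every channel $\mathcal C_V$ of the above form that realizes $V$ with efficiency $2^{-k/2}$ (in particular the one in 1), given any purification $W$ of $\mathcal C_V$ with $e$ environment qubits as oracle, each outputs with probability at least $2/3$ a number within $\epsilon$ of the real part, respectively the imaginary part, of $\langle +|^{\otimes n}U|0\rangle^{\otimes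 n}$. -/

import Mathlib

open scoped Kronecker Matrix

/-! ### Qubit registers, gates and circuits -/

/-- Computational basis labels of a register of qubits whose wires are labelled by `ι`. -/
abbrev Bits (ι : Type) : Type := ι → Bool

/-- The one-qubit Hadamard matrix. -/
noncomputable def hadamard : Matrix Bool Bool ℂ :=
  Matrix.of fun a b => ((1 / Real.sqrt 2 : ℝ) : ℂ) * (if a && b then -1 else 1)

/-- The gate set `{H, S, T, CNOT}` on a register with wires `ι`
(`CNOT c t` has control `c` and target `t`). -/
inductive Gate (ι : Type) : Type
  | H (i : ι) : Gate ι
  | S (i : ι) : Gate ι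
  | T (i : ι) : Gate ι
  | CNOT (c t : ι) (h : c ≠ t) : Gate ι

/-- The unitary matrix of a gate on the whole register. -/
noncomputable def Gate.toMatrix {ι : Type} [Fintype ι] [DecidableEq ι] :
    Gate ι → Matrix (Bits ι) (Bits ι) ℂ
  | .H i => Matrix.of fun x y => if ∀ j, j ≠ i → x j = y j then hadamard (x i) (y i) else 0
  | .S i => Matrix.diagonal fun x => if x i then Complex.I else 1
  | .T i => Matrix.diagonal fun x =>
      if x i then Complex.exp (Complex.I * ((Real.pi / 4 : ℝ) : ℂ)) else 1
  | .CNOT c t _ => Matrix.of fun x y =>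
      if x = Function.update y t (xor (y t) (y c)) then 1 else 0

/-- Whether a gate is a Hadamard gate. -/
def Gate.isH {ι : Type} : Gate ι → Bool
  | .H _ => true
  | _ => false

/-- A circuit over `{H, S, T, CNOT}`: a list of gates, the head being applied first.
Its gate complexity is the length of the list. -/
abbrev Circuit (ι : Type) : Type := List (Gate ι)

/-- The unitary matrix of a circuit. -/
noncomputable def Circuit.toMatrix {ι : Type} [Fintype ι] [DecidableEq ι] :
    Circuit ι → Matrix (Bits ι) (Bits ι) ℂ
  | [] => 1
  | g :: gs => Circuit.toMatrix gs * g.toMatrix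

/-- The number of Hadamard gates of a circuit. -/
def Circuit.hadamardCount {ι : Type} (U : Circuit ι) : ℕ := List.countP Gate.isH U

/-- The state `|0⟩^{⊗ι}`. -/
noncomputable def ketZero (ι : Type) [Fintype ι] : Bits ι → ℂ :=
  fun x => if x = fun _ => false then 1 else 0

/-- The state `|+⟩^{⊗ι}`. -/
noncomputable def ketPlus (ι : Type) [Fintype ι] : Bits ι → ℂ :=
  fun _ => ((1 / Real.sqrt 2 : ℝ) : ℂ) ^ Fintype.card ι

/-- `H^{⊗ι}`. -/
noncomputable def hadamardAll (ι : Type) [Fintype ι] : Matrix (Bits ι) (Bits ι) ℂ :=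
  Matrix.of fun x y => ∏ i, hadamard (x i) (y i)

/-- The amplitude `⟨+|^{⊗n} U |0⟩^{⊗n}`. -/
noncomputable def plusZeroAmplitude {n : ℕ} (U : Circuit (Fin n)) : ℂ :=
  star (ketPlus (Fin n)) ⬝ᵥ (U.toMatrix *ᵥ ketZero (Fin n))

/-- `V = H^{⊗n} U H^{⊗n}`. -/
noncomputable def conjHadamard {n : ℕ} (U : Circuit (Fin n)) :
    Matrix (Bits (Fin n)) (Bits (Fin n)) ℂ :=
  hadamardAll (Fin n) * U.toMatrix * hadamardAll (Fin n)

/-! ### Channels of block form and channel block encodings -/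

/-- The operator `|0⟩⟨0| ⊗ K + |1⟩⟨1| ⊗ L` on assistant qubit and encoding system. -/
def blockOp {n : ℕ} (K L : Matrix (Bits (Fin n)) (Bits (Fin n)) ℂ) :
    Matrix (Bool × Bits (Fin n)) (Bool × Bits (Fin n)) ℂ :=
  Matrix.of fun p q => if p.1 = q.1 then (if p.1 then L p.2 q.2 else K p.2 q.2) else 0

/-- A quantum channel on `1 + n` qubits given by block diagonal Kraus operators
`|0⟩⟨0| ⊗ Kᵢ + |1⟩⟨1| ⊗ Lᵢ`. -/
structure BlockChannel (n : ℕ) where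
  κ : Type
  [fintypeκ : Fintype κ]
  K : κ → Matrix (Bits (Fin n)) (Bits (Fin n)) ℂ
  L : κ → Matrix (Bits (Fin n)) (Bits (Fin n)) ℂ
  sum_K : ∑ i, (K i)ᴴ * K i = 1
  sum_L : ∑ i, (L i)ᴴ * L i = 1

attribute [instance] BlockChannel.fintypeκ

/-- The action `ρ ↦ ∑ᵢ Mᵢ ρ Mᵢ†` of the channel. -/
noncomputable def BlockChannel.apply {n : ℕ} (C : BlockChannel n)
    (ρ : Matrix (Bool × Bits (Fin n)) (Bool × Bits (Fin n)) ℂ) :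
    Matrix (Bool × Bits (Fin n)) (Bool × Bits (Fin n)) ℂ :=
  ∑ i, blockOp (C.K i) (C.L i) * ρ * (blockOp (C.K i) (C.L i))ᴴ

/-- `C` is an `η`-channel block encoding of the `2n`-qubit operator `Q`:
`∑ᵢ Kᵢ ⊗ Lᵢ^* = η Q`, where `^*` is the entrywise complex conjugate. -/
def BlockChannel.IsCBE {n : ℕ} (C : BlockChannel n) (η : ℝ)
    (Q : Matrix (Bits (Fin n) × Bits (Fin n)) (Bits (Fin n) × Bits (Fin n)) ℂ) : Prop :=
  0 < η ∧ ∑ i, C.K i ⊗ₖ (C.L i).map star = (η : ℂ) • Q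

/-- The Bell circuit on `n` pairs of qubits, `U_B^{⊗n} = (H^{⊗n} ⊗ I) CNOT^{⊗n}`, where the
`i`-th CNOT has its control in the front register and its target in the back register. -/
noncomputable def bellCircuit (n : ℕ) :
    Matrix (Bits (Fin n) × Bits (Fin n)) (Bits (Fin n) × Bits (Fin n)) ℂ :=
  (hadamardAll (Fin n) ⊗ₖ (1 : Matrix (Bits (Fin n)) (Bits (Fin n)) ℂ)) *
    Matrix.of fun p q => if p = (q.1, fun i => xor (q.2 i) (q.1 i)) then 1 else 0

/-- `C` realizes `V` in Pauli quantum computing with efficiency `η`: for some `F₀` with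
`F₀|0⟩ = |0⟩`, it is an `η`-channel block encoding of `U_B†^{⊗n} (F₀ ⊗ V) U_B^{⊗n}`. -/
def BlockChannel.Realizes {n : ℕ} (C : BlockChannel n) (η : ℝ)
    (V : Matrix (Bits (Fin n)) (Bits (Fin n)) ℂ) : Prop :=
  ∃ F₀ : Matrix (Bits (Fin n)) (Bits (Fin n)) ℂ,
    F₀ *ᵥ ketZero (Fin n) = ketZero (Fin n) ∧
      C.IsCBE η ((bellCircuit n)ᴴ * (F₀ ⊗ₖ V) * bellCircuit n)

/-! ### Unitary purifications of channels -/

/-- The wires of a purification: the assistant qubit, `n` encoding qubits and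
`e` environment qubits. -/
abbrev Wires (n e : ℕ) : Type := Unit ⊕ (Fin n ⊕ Fin e)

/-- The basis label with assistant and encoding part `p` and environment part `s`. -/
def joinBits {n e : ℕ} (p : Bool × Bits (Fin n)) (s : Bits (Fin e)) : Bits (Wires n e) :=
  Sum.elim (fun _ => p.1) (Sum.elim p.2 s)

/-- `ρ ⊗ |0⟩⟨0|`, with the environment in the state `|0⟩^{⊗e}`. -/
def withEnv {n e : ℕ} (ρ : Matrix (Bool × Bits (Fin n)) (Bool × Bits (Fin n)) ℂ) :
    Matrix (Bits (Wires n e)) (Bits (Wires n e)) ℂ :=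
  Matrix.of fun x y =>
    if (∀ j, x (.inr (.inr j)) = false) ∧ (∀ j, y (.inr (.inr j)) = false) then
      ρ (x (.inl ()), fun i => x (.inr (.inl i))) (y (.inl ()), fun i => y (.inr (.inl i)))
    else 0

/-- The partial trace over the environment. -/
noncomputable def traceEnv {n e : ℕ} (M : Matrix (Bits (Wires n e)) (Bits (Wires n e)) ℂ) :
    Matrix (Bool × Bits (Fin n)) (Bool × Bits (Fin n)) ℂ :=
  Matrix.of fun p q => ∑ s : Bits (Fin e), M (joinBits p s) (joinBits q s)

/-- The unitary `W` is a purification of the channel `C`: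
`C[ρ] = Tr_env (W (ρ ⊗ |0⟩⟨0|) W†)` for all `ρ`. -/
def BlockChannel.IsPurifiedBy {n e : ℕ} (C : BlockChannel n)
    (W : Matrix (Bits (Wires n e)) (Bits (Wires n e)) ℂ) : Prop :=
  W ∈ Matrix.unitaryGroup (Bits (Wires n e)) ℂ ∧
    ∀ ρ, C.apply ρ = traceEnv (W * withEnv ρ * Wᴴ)

/-! ### Quantum query algorithms -/

/-- A quantum algorithm with oracle access to an unknown unitary on the wires `ι`, with `work`
further qubits of workspace. It starts in the all-zero state, applies the unitary `init`, and
then, for each element `(b, G)` of `steps` in turn, makes one query, to the oracle (`b = false`)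
or to its inverse (`b = true`), and applies the unitary `G`. Finally all qubits are measured in
the computational basis, and a real number is computed from the outcome. -/
structure QueryAlgorithm (ι : Type) [Fintype ι] [DecidableEq ι] where
  work : ℕ
  init : Matrix.unitaryGroup (Bits ι × Bits (Fin work)) ℂ
  steps : List (Bool × Matrix.unitaryGroup (Bits ι × Bits (Fin work)) ℂ)
  output : Bits ι × Bits (Fin work) → ℝ

namespace QueryAlgorithm

variable {ι : Type} [Fintype ι] [DecidableEq ι]

/-- The number of queries made to the oracle and its inverse. -/
def queries (A : QueryAlgorithm ι) : ℕ := A.steps.length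

/-- The action of one query on the oracle register and the workspace. -/
noncomputable def query (A : QueryAlgorithm ι) (W : Matrix (Bits ι) (Bits ι) ℂ) (b : Bool) :
    Matrix (Bits ι × Bits (Fin A.work)) (Bits ι × Bits (Fin A.work)) ℂ :=
  (if b then Wᴴ else W) ⊗ₖ (1 : Matrix (Bits (Fin A.work)) (Bits (Fin A.work)) ℂ)

/-- The state before the measurement, when the oracle is `W`. -/
noncomputable def finalState (A : QueryAlgorithm ι) (W : Matrix (Bits ι) (Bits ι) ℂ) :
    Bits ι × Bits (Fin A.work) → ℂ :=
  A.steps.foldl (fun ψ s => s.2.1 *ᵥ (A.query W s.1 *ᵥ ψ))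
    (A.init.1 *ᵥ fun z => ketZero ι z.1 * ketZero (Fin A.work) z.2)

open Classical in
/-- The probability that the output is within `ε` of `a`, when the oracle is `W`. -/
noncomputable def successProb (A : QueryAlgorithm ι) (W : Matrix (Bits ι) (Bits ι) ℂ)
    (a ε : ℝ) : ℝ :=
  ∑ z, if |A.output z - a| ≤ ε then ‖A.finalState W z‖ ^ 2 else 0

end QueryAlgorithm

set_option linter.unusedSectionVars false

/-! ### Unitary matrices, reflections, and measurement of a Hermitian matrix in its eigenbasis. -/

section UnitaryMatrices

variable {I J : Type} [Fintype I] [DecidableEq I] [Fintype J] [DecidableEq J]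

/-! The estimate rests on a large signal in the assistant qubit. Let `χ` be the result of applying
`W` to `|+⟩|+⟩^{⊗n}|0⟩^{⊗e}`. The off-diagonal assistant block of its reduced state has trace `T =
2^{-n}/2 · ⟨Φ| ∑ᵢ Kᵢ ⊗ Lᵢ^* |1⟩`, with `Φ = ∑ₓ |x,x⟩` and `1` the all-ones vector. The Bell circuit
sends `Φ` to `2^{n/2}|0⟩|0⟩` and `1` to `2^n |0⟩|+⟩^{⊗n}`, so only `⟨0|F₀|0⟩ = 1` and `⟨0|V|+⟩^{⊗n}
= ⟨+|^{⊗n}U|0⟩` enter. Hence `2T = 2^{(n-k)/2} ⟨+|^{⊗n}U|0⟩`: the amplitude is seen magnified by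
`2^{(n-k)/2}`, and precision `ε 2^{(n-k)/2}` on the signal is enough
(`sum_offDiagonal_of_isPurifiedBy`, `sum_blocks_of_realizes`). Its real and imaginary parts are
expectations `x = ⟨χ|R|χ⟩` of Hermitian involutions `R` that flip the assistant qubit.

Such an `x` is estimated to within `δ` by `O(1/δ)` queries without phase estimation. With `G =
(2|χ⟩⟨χ| - 1)R` the states `ψ t = G^t χ` obey the Chebyshev recurrence `ψ (t+2) + ψ t = 2x ψ (t+1)`.
A superposition `∑ₜ w t |t⟩ ψ t` with slowly varying window `w` is therefore nearly an eigenvector,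
with eigenvalue `x`, of half the adjacency matrix of a path acting on the clock `t`. Measuring that
matrix gives mean square error at most `4/N²` for a path of `2N` vertices
(`exists_steps_sum_sub_sq_le`), and Markov's inequality finishes.

For the construction of the channel, a gadget is described by its operator `∑ₛ Kₛ ⊗ Lₛ^*`. Gadgets
with separate environments compose multiplicatively (`transferMat_embedMat_mul`), so one gadget per
gate suffices (`exists_implements_of_gates`). Diagonal gates and CNOT cost no efficiency. A Hadamard
gate is encoded by Kraus operators `|t⟩⟨s|/√2` in the `X` basis with relative sign `(-1)^{st}`
between the two assistant branches, which costs a factor `1/√2`. -/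

theorem star_dotProduct_self_eq_sum (v : I → ℂ) :
    star v ⬝ᵥ v = ((∑ i, ‖v i‖ ^ 2 : ℝ) : ℂ) := by
  simp only [dotProduct, Pi.star_apply, RCLike.star_def, Complex.ofReal_sum]
  refine Finset.sum_congr rfl fun i _ => ?_
  rw [Complex.conj_mul', Complex.ofReal_pow]

theorem star_mulVec_dotProduct_mulVec {U : Matrix I I ℂ} (hU : U ∈ Matrix.unitaryGroup I ℂ)
    (v w : I → ℂ) : star (U *ᵥ v) ⬝ᵥ (U *ᵥ w) = star v ⬝ᵥ w := by
  rw [Matrix.star_mulVec, ← Matrix.dotProduct_mulVec, Matrix.mulVec_mulVec]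
  have : Uᴴ * U = 1 := Matrix.mem_unitaryGroup_iff'.1 hU
  rw [this, Matrix.one_mulVec]

theorem sum_norm_sq_mulVec {U : Matrix I I ℂ} (hU : U ∈ Matrix.unitaryGroup I ℂ) (v : I → ℂ) :
    ∑ i, ‖(U *ᵥ v) i‖ ^ 2 = ∑ i, ‖v i‖ ^ 2 := by
  have h := star_mulVec_dotProduct_mulVec hU v v
  rw [star_dotProduct_self_eq_sum, star_dotProduct_self_eq_sum] at h
  exact_mod_cast h

theorem exists_unitary_mulVec_single (i₀ : I) (v : I → ℂ) (hv : ∑ i, ‖v i‖ ^ 2 = 1) :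
    ∃ Q ∈ Matrix.unitaryGroup I ℂ, Q *ᵥ Pi.single i₀ 1 = v := by
  -- The unit vector is completed to an orthonormal basis indexed by `I` itself, with `v` in
  -- position `i₀`; the basis vectors are the columns of `Q`.
  obtain ⟨b, hb⟩ := Orthonormal.exists_orthonormalBasis_extension_of_card_eq (𝕜 := ℂ)
    (E := EuclideanSpace ℂ I) (ι := I) (by simp) (v := fun _ => WithLp.toLp 2 v) (s := {i₀}) (by
      rw [orthonormal_subsingleton_iff]
      intro _
      simp [EuclideanSpace.norm_eq, hv])
  refine ⟨Matrix.of fun i j => b j i, ?_, ?_⟩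
  · rw [Matrix.mem_unitaryGroup_iff']
    ext i j
    have h := orthonormal_iff_ite.1 b.orthonormal i j
    rw [Matrix.mul_apply, Matrix.one_apply, ← h]
    simp [PiLp.inner_apply, mul_comm]
  · ext i
    simp [hb i₀ rfl]

theorem blockDiagonal_mulVec (M : J → Matrix I I ℂ) (Φ : I × J → ℂ) (x : I) (t : J) :
    (Matrix.blockDiagonal M *ᵥ Φ) (x, t) = (M t *ᵥ fun y => Φ (y, t)) x := by
  simp [Matrix.mulVec, dotProduct, Matrix.blockDiagonal_apply, Fintype.sum_prod_type, ite_mul]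

theorem kronecker_one_mulVec (M : Matrix I I ℂ) (Φ : I × J → ℂ) (x : I) (t : J) :
    ((M ⊗ₖ (1 : Matrix J J ℂ)) *ᵥ Φ) (x, t) = (M *ᵥ fun y => Φ (y, t)) x := by
  simp [Matrix.mulVec, dotProduct, Matrix.one_apply, Fintype.sum_prod_type]

theorem one_kronecker_mulVec (Q : Matrix J J ℂ) (Φ : I × J → ℂ) (x : I) (t : J) :
    (((1 : Matrix I I ℂ) ⊗ₖ Q) *ᵥ Φ) (x, t) = (Q *ᵥ fun s => Φ (x, s)) t := by
  simp [Matrix.mulVec, dotProduct, Matrix.one_apply, Fintype.sum_prod_type, ite_mul]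

theorem blockDiagonal_mem_unitaryGroup {M : J → Matrix I I ℂ}
    (hM : ∀ t, M t ∈ Matrix.unitaryGroup I ℂ) :
    Matrix.blockDiagonal M ∈ Matrix.unitaryGroup (I × J) ℂ := by
  rw [Matrix.mem_unitaryGroup_iff, Matrix.star_eq_conjTranspose,
    Matrix.blockDiagonal_conjTranspose, ← Matrix.blockDiagonal_mul]
  have : (fun k => M k * (M k)ᴴ) = 1 := funext fun t => Matrix.mem_unitaryGroup_iff.1 (hM t)
  rw [this, Matrix.blockDiagonal_one]

theorem ite_mem_unitaryGroup {p : Prop} [Decidable p] {R : Matrix I I ℂ}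
    (hR : R ∈ Matrix.unitaryGroup I ℂ) :
    (if p then R else 1) ∈ Matrix.unitaryGroup I ℂ := by
  split_ifs
  · exact hR
  · exact one_mem _

/-- The reflection `2 |s⟩⟨s| - 1`. -/
noncomputable def reflection (s : I → ℂ) : Matrix I I ℂ :=
  (2 : ℂ) • Matrix.vecMulVec s (star s) - 1

theorem reflection_mulVec (s v : I → ℂ) :
    reflection s *ᵥ v = (2 * (star s ⬝ᵥ v)) • s - v := by
  rw [reflection, Matrix.sub_mulVec, Matrix.smul_mulVec, Matrix.vecMulVec_mulVec,
    Matrix.one_mulVec, op_smul_eq_smul, smul_smul]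

theorem reflection_mem_unitaryGroup {s : I → ℂ} (hs : ∑ i, ‖s i‖ ^ 2 = 1) :
    reflection s ∈ Matrix.unitaryGroup I ℂ := by
  have h1 : star s ⬝ᵥ s = 1 := by rw [star_dotProduct_self_eq_sum, hs]; simp
  have hH : (reflection s)ᴴ = reflection s := by
    ext i j
    simp [reflection, Matrix.vecMulVec_apply, Matrix.conjTranspose_apply, Matrix.one_apply,
      mul_comm, eq_comm]
  rw [Matrix.mem_unitaryGroup_iff, Matrix.star_eq_conjTranspose, hH]
  refine Matrix.ext_iff_mulVec.2 fun v => ?_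
  rw [← Matrix.mulVec_mulVec, reflection_mulVec s v, reflection_mulVec, Matrix.one_mulVec]
  rw [dotProduct_sub, dotProduct_smul, h1]
  ext i
  simp
  ring

/-- The mean square deviation from `x` when an observable is measured in its eigenbasis. -/
theorem sum_eigenvalues_sub_sq_mul {A : Matrix J J ℂ} (hA : A.IsHermitian) (x : ℝ) (φ : J → ℂ) :
    ∑ j, (hA.eigenvalues j - x) ^ 2 *
        ‖(((hA.eigenvectorUnitary : Matrix J J ℂ)ᴴ) *ᵥ φ) j‖ ^ 2 =
      ∑ t, ‖(A *ᵥ φ) t - x * φ t‖ ^ 2 := by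
  set U := (hA.eigenvectorUnitary : Matrix J J ℂ) with hUdef
  have hU : U ∈ Matrix.unitaryGroup J ℂ := hA.eigenvectorUnitary.2
  have hU' : Uᴴ ∈ Matrix.unitaryGroup J ℂ := Unitary.star_mem hU
  -- In the eigenbasis `A - x` is multiplication by `λⱼ - x`, so the claim is that `Uᴴ` preserves
  -- the norm of `(A - x)φ`.
  have key : Uᴴ *ᵥ (A *ᵥ φ - (x : ℂ) • φ) =
      fun j => ((hA.eigenvalues j - x : ℝ) : ℂ) * (Uᴴ *ᵥ φ) j := by
    have h : Uᴴ * A = Matrix.diagonal (fun j => (hA.eigenvalues j : ℂ)) * Uᴴ := by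
      have hs := hA.spectral_theorem
      have h1 : Uᴴ * U = 1 := Matrix.mem_unitaryGroup_iff'.1 hU
      conv_lhs => rw [hs]
      rw [Unitary.conjStarAlgAut_apply]
      simp only [Matrix.star_eq_conjTranspose, ← hUdef]
      rw [← Matrix.mul_assoc, ← Matrix.mul_assoc, h1, Matrix.one_mul]
      rfl
    rw [Matrix.mulVec_sub, Matrix.mulVec_mulVec, h, ← Matrix.mulVec_mulVec, Matrix.mulVec_smul]
    ext j
    rw [Pi.sub_apply, Matrix.mulVec_diagonal]
    simp [sub_mul]
  have h2 := sum_norm_sq_mulVec hU' (A *ᵥ φ - (x : ℂ) • φ)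
  rw [key] at h2
  simp only [Pi.sub_apply, Pi.smul_apply, smul_eq_mul] at h2
  rw [← h2]
  refine Finset.sum_congr rfl fun j _ => ?_
  rw [norm_mul, mul_pow, Complex.norm_real, Real.norm_eq_abs, sq_abs]

end UnitaryMatrices

/-! ### Grover iterates and their Chebyshev recurrence. -/

section Grover

variable {I : Type} [Fintype I] [DecidableEq I]

/-- The Grover iterate `W (2 |s⟩⟨s| - 1) W† R`. -/
noncomputable def groverIterate (s : I → ℂ) (R W : Matrix I I ℂ) : Matrix I I ℂ :=
  W * reflection s * Wᴴ * R

variable {s : I → ℂ} {R W : Matrix I I ℂ}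

theorem groverIterate_mem_unitaryGroup (hs : ∑ i, ‖s i‖ ^ 2 = 1)
    (hR : R ∈ Matrix.unitaryGroup I ℂ) (hW : W ∈ Matrix.unitaryGroup I ℂ) :
    groverIterate s R W ∈ Matrix.unitaryGroup I ℂ :=
  mul_mem (mul_mem (mul_mem hW (reflection_mem_unitaryGroup hs)) (Unitary.star_mem hW)) hR

theorem conj_reflection_mulVec (hW : W ∈ Matrix.unitaryGroup I ℂ) (v : I → ℂ) :
    (W * reflection s * Wᴴ) *ᵥ v = (2 * (star (W *ᵥ s) ⬝ᵥ v)) • (W *ᵥ s) - v := by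
  have hW' : W * Wᴴ = 1 := Matrix.mem_unitaryGroup_iff.1 hW
  rw [← Matrix.mulVec_mulVec, ← Matrix.mulVec_mulVec, reflection_mulVec, Matrix.mulVec_sub,
    Matrix.mulVec_smul, Matrix.mulVec_mulVec v W, hW', Matrix.one_mulVec, Matrix.star_mulVec,
    ← Matrix.dotProduct_mulVec]

/-- The Chebyshev recurrence for the Grover iterates of the marked state. -/
theorem groverIterate_pow_recurrence (hs : ∑ i, ‖s i‖ ^ 2 = 1)
    (hR2 : R * R = 1) (hW : W ∈ Matrix.unitaryGroup I ℂ) {x : ℝ}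
    (hx : star (W *ᵥ s) ⬝ᵥ (R *ᵥ (W *ᵥ s)) = x) (t : ℕ) :
    (groverIterate s R W ^ (t + 2)) *ᵥ (W *ᵥ s) + (groverIterate s R W ^ t) *ᵥ (W *ᵥ s) =
      (2 * x : ℂ) • ((groverIterate s R W ^ (t + 1)) *ᵥ (W *ᵥ s)) := by
  set χ := W *ᵥ s with hχ
  set G := groverIterate s R W with hG
  have hn : star χ ⬝ᵥ χ = 1 := by
    rw [star_mulVec_dotProduct_mulVec hW, star_dotProduct_self_eq_sum, hs]; simp
  have hG1 : G *ᵥ χ = (2 * x : ℂ) • χ - R *ᵥ χ := by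
    rw [hG, groverIterate, ← Matrix.mulVec_mulVec, conj_reflection_mulVec hW, ← hχ, hx]
  -- Since `R² = 1`, `G` takes `R χ` to the reflection of `χ` about itself. Together with `hG1`, the
  -- plane spanned by `χ` and `R χ` is invariant.
  have hG2 : G *ᵥ (R *ᵥ χ) = χ := by
    rw [hG, groverIterate, ← Matrix.mulVec_mulVec, Matrix.mulVec_mulVec χ R R, hR2,
      Matrix.one_mulVec, conj_reflection_mulVec hW, ← hχ, hn]
    ext i; simp; ring
  have h2 : (G ^ 2) *ᵥ χ + χ = (2 * x : ℂ) • (G *ᵥ χ) := by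
    rw [pow_two, ← Matrix.mulVec_mulVec]
    nth_rewrite 1 [hG1]
    rw [Matrix.mulVec_sub, Matrix.mulVec_smul, hG2]
    abel
  rw [pow_add _ t 2, pow_succ G t, ← Matrix.mulVec_mulVec, ← Matrix.mulVec_mulVec,
    ← Matrix.mulVec_add, h2, Matrix.mulVec_smul]

/-- Cauchy–Schwarz through the arithmetic–geometric mean inequality. It lets a tolerance of at least
`1` be met without any query. -/
theorem abs_le_one_of_expectation {χ : I → ℂ} (hχ : ∑ i, ‖χ i‖ ^ 2 = 1)
    (hR : R ∈ Matrix.unitaryGroup I ℂ) {x : ℝ} (hx : star χ ⬝ᵥ (R *ᵥ χ) = x) : |x| ≤ 1 := by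
  have h1 : |x| = ‖star χ ⬝ᵥ (R *ᵥ χ)‖ := by rw [hx, Complex.norm_real, Real.norm_eq_abs]
  rw [h1]
  calc ‖star χ ⬝ᵥ (R *ᵥ χ)‖ ≤ ∑ i, ‖star χ i * (R *ᵥ χ) i‖ := norm_sum_le _ _
    _ ≤ ∑ i, (‖χ i‖ ^ 2 + ‖(R *ᵥ χ) i‖ ^ 2) / 2 := by
        refine Finset.sum_le_sum fun i _ => ?_
        rw [norm_mul, Pi.star_apply, norm_star]
        nlinarith [sq_nonneg (‖χ i‖ - ‖(R *ᵥ χ) i‖)]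
    _ = 1 := by
        rw [← Finset.sum_div, Finset.sum_add_distrib, sum_norm_sq_mulVec hR, hχ]; norm_num

end Grover

/-! ### The triangular window: zero at both ends, slope at most one, large norm. -/

section Window

/-- The triangular window on `{0, …, 2 N}`. -/
noncomputable def window (N t : ℕ) : ℝ := ((min t (2 * N - t) : ℕ) : ℝ)

theorem window_zero (N : ℕ) : window N 0 = 0 := by simp [window]

theorem window_two_mul (N : ℕ) : window N (2 * N) = 0 := by simp [window]

theorem abs_window_succ_sub_le (N t : ℕ) : |window N (t + 1) - window N t| ≤ 1 := by
  unfold window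
  have h1 : min (t + 1) (2 * N - (t + 1)) ≤ min t (2 * N - t) + 1 := by omega
  have h2 : min t (2 * N - t) ≤ min (t + 1) (2 * N - (t + 1)) + 1 := by omega
  rw [abs_le]
  constructor
  · have : ((min t (2 * N - t) : ℕ) : ℝ) ≤ ((min (t + 1) (2 * N - (t + 1)) + 1 : ℕ) : ℝ) :=
      Nat.cast_le.2 h2
    rw [Nat.cast_add, Nat.cast_one] at this
    linarith
  · have : ((min (t + 1) (2 * N - (t + 1)) : ℕ) : ℝ) ≤ ((min t (2 * N - t) + 1 : ℕ) : ℝ) :=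
      Nat.cast_le.2 h1
    rw [Nat.cast_add, Nat.cast_one] at this
    linarith

/-- Pairing `t` with `N + t` gives `t² + (N - t)² ≥ N²/2` for each of the `N` pairs. -/
theorem le_sum_window_sq (N : ℕ) :
    (N : ℝ) ^ 3 / 2 ≤ ∑ t ∈ Finset.range (2 * N), window N t ^ 2 := by
  rw [two_mul N, Finset.sum_range_add, ← Finset.sum_add_distrib]
  have h : ∀ t ∈ Finset.range N, (N : ℝ) ^ 2 / 2 ≤ window N t ^ 2 + window N (N + t) ^ 2 := by
    intro t ht
    have ht' := Finset.mem_range.1 ht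
    have h1 : window N t = t := by unfold window; congr 1; omega
    have h2 : window N (N + t) = N - t := by
      unfold window; rw [← Nat.cast_sub ht'.le]; congr 1; omega
    rw [h1, h2]
    nlinarith [sq_nonneg ((N : ℝ) - 2 * t)]
  calc (N : ℝ) ^ 3 / 2 = ∑ _t ∈ Finset.range N, (N : ℝ) ^ 2 / 2 := by
        rw [Finset.sum_const, Finset.card_range, nsmul_eq_mul]; ring
    _ ≤ _ := Finset.sum_le_sum h

end Window

/-! ### The path observable and its approximate eigenvectors. -/

section PathObservable

/-- Half the adjacency matrix of the path on `M` vertices. -/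
noncomputable def pathMatrix (M : ℕ) : Matrix (Fin M) (Fin M) ℂ :=
  Matrix.of fun i j => if (i : ℕ) + 1 = j ∨ (j : ℕ) + 1 = i then 1 / 2 else 0

theorem pathMatrix_isHermitian (M : ℕ) : (pathMatrix M).IsHermitian := by
  ext i j
  simp only [pathMatrix, Matrix.conjTranspose_apply, Matrix.of_apply]
  by_cases h : (i : ℕ) + 1 = j ∨ (j : ℕ) + 1 = i
  · rw [if_pos h, if_pos h.symm]; simp
  · rw [if_neg h, if_neg fun h' => h h'.symm]; simp

/-- The condition `g M = 0` makes cutting the path at its right end harmless. The left end needs a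
case distinction because `0 - 1 = 0` in `ℕ`. -/
theorem pathMatrix_mulVec {M : ℕ} (g : ℕ → ℂ) (hg : g M = 0) (t : Fin M) :
    (pathMatrix M *ᵥ fun i => g i) t =
      (g (t + 1) + if (t : ℕ) = 0 then 0 else g (t - 1)) / 2 := by
  obtain ⟨t, ht⟩ := t
  simp only [Matrix.mulVec, dotProduct, pathMatrix, Matrix.of_apply]
  rw [Fin.sum_univ_eq_sum_range
    (fun j => (if t + 1 = j ∨ j + 1 = t then (1 / 2 : ℂ) else 0) * g j) M]
  have hsplit : ∀ j, (if t + 1 = j ∨ j + 1 = t then (1 / 2 : ℂ) else 0) * g j =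
      (if t + 1 = j then g j / 2 else 0) + (if j + 1 = t then g j / 2 else 0) := by
    intro j
    by_cases h1 : t + 1 = j
    · have h2 : ¬ (j + 1 = t) := by omega
      simp [h1, h2]; ring
    · simp only [h1, false_or, if_false, zero_add]
      split_ifs <;> ring
  rw [Finset.sum_congr rfl fun j _ => hsplit j, Finset.sum_add_distrib, Finset.sum_ite_eq, add_div]
  congr 1
  · split_ifs with h
    · rfl
    · have : t + 1 = M := by simp at h; omega
      rw [this, hg, zero_div]
  · cases t with
    | zero => simp
    | succ t =>
      simp only [add_left_inj, Nat.add_eq_zero_iff, one_ne_zero, and_false, if_false,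
        Nat.add_sub_cancel]
      rw [Finset.sum_ite_eq', if_pos (Finset.mem_range.2 (by omega))]

variable {I : Type} [Fintype I]

theorem norm_sq_add_le (u v : ℂ) : ‖u + v‖ ^ 2 ≤ 2 * ‖u‖ ^ 2 + 2 * ‖v‖ ^ 2 := by
  have := norm_add_le u v
  nlinarith [norm_nonneg (u + v), norm_nonneg u, norm_nonneg v, sq_nonneg (‖u‖ - ‖v‖)]

/-- A windowed solution of the Chebyshev recurrence is an approximate eigenvector of the path
matrix. -/
theorem sum_pathMatrix_sub_sq_le {N : ℕ} {x : ℝ} {ψ : ℕ → I → ℂ}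
    (hψ : ∀ t, ∑ i, ‖ψ t i‖ ^ 2 = 1)
    (hrec : ∀ t, ψ (t + 2) + ψ t = (2 * x : ℂ) • ψ (t + 1)) :
    ∑ i, ∑ t : Fin (2 * N),
      ‖(pathMatrix (2 * N) *ᵥ fun t => (window N t : ℂ) * ψ t i) t -
        x * ((window N t : ℂ) * ψ t i)‖ ^ 2 ≤ 2 * N := by
  rw [Finset.sum_comm]
  have hterm : ∀ t : Fin (2 * N), ∑ i,
      ‖(pathMatrix (2 * N) *ᵥ fun t => (window N t : ℂ) * ψ t i) t -
        x * ((window N t : ℂ) * ψ t i)‖ ^ 2 ≤ 1 := by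
    rintro ⟨t, ht⟩
    have hsq : ∀ (t : ℕ) (c : ℝ), |c| ≤ 1 → ∑ i, ‖(c : ℂ) * ψ t i‖ ^ 2 ≤ 1 := by
      intro t c hc
      have h1 : ∀ i, ‖(c : ℂ) * ψ t i‖ ^ 2 = c ^ 2 * ‖ψ t i‖ ^ 2 := fun i => by
        rw [norm_mul, mul_pow, Complex.norm_real, Real.norm_eq_abs, sq_abs]
      rw [Finset.sum_congr rfl fun i _ => h1 i, ← Finset.mul_sum, hψ, mul_one]
      exact (sq_le_one_iff_abs_le_one c).2 hc
    have hmv : ∀ i, (pathMatrix (2 * N) *ᵥ fun t => (window N t : ℂ) * ψ t i) ⟨t, ht⟩ = _ :=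
      fun i => pathMatrix_mulVec (fun t => (window N t : ℂ) * ψ t i)
        (by simp [window_two_mul]) ⟨t, ht⟩
    cases t with
    | zero =>
      -- At the left end the window vanishes, so the absent left neighbour plays no role and only
      -- half of `w 1 • ψ 1` remains.
      have h1 : ∀ i, ‖(pathMatrix (2 * N) *ᵥ fun t => (window N t : ℂ) * ψ t i) ⟨0, ht⟩ -
          x * ((window N (0 : ℕ) : ℂ) * ψ 0 i)‖ ^ 2 ≤ ‖((window N 1 - window N 0 : ℝ) : ℂ) *
            ψ 1 i‖ ^ 2 := by
        intro i
        rw [hmv]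
        simp only [window_zero, if_true, zero_add]
        simp only [Complex.ofReal_zero, zero_mul, mul_zero, sub_zero, add_zero, norm_div,
          Complex.norm_ofNat]
        have := norm_nonneg ((window N 1 : ℂ) * ψ 1 i)
        exact pow_le_pow_left₀ (by positivity) (by linarith) 2
      exact (Finset.sum_le_sum fun i _ => h1 i).trans (hsq 1 _ (abs_window_succ_sub_le N 0))
    | succ t =>
      have h1 : ∀ i, ‖(pathMatrix (2 * N) *ᵥ fun t => (window N t : ℂ) * ψ t i) ⟨t + 1, ht⟩ -
          x * ((window N (t + 1 : ℕ) : ℂ) * ψ (t + 1) i)‖ ^ 2 ≤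
            (‖((window N (t + 1 + 1) - window N (t + 1) : ℝ) : ℂ) * ψ (t + 2) i‖ ^ 2 +
            ‖((window N t - window N (t + 1) : ℝ) : ℂ) * ψ t i‖ ^ 2) / 2 := by
        intro i
        rw [hmv]
        have hr : ψ (t + 1 + 1) i + ψ t i = 2 * x * ψ (t + 1) i := by
          simpa using congrFun (hrec t) i
        simp only [Nat.add_eq_zero_iff, one_ne_zero, and_false, if_false, Nat.add_sub_cancel]
        -- Writing `x ψ (t+1)` as the mean of its neighbours by the recurrence leaves only
        -- increments of the window, each at most one in absolute value.
        have he : ((window N (t + 1 + 1) : ℂ) * ψ (t + 1 + 1) i + (window N t : ℂ) * ψ t i) / 2 -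
            x * ((window N (t + 1) : ℂ) * ψ (t + 1) i) =
            (((window N (t + 1 + 1) - window N (t + 1) : ℝ) : ℂ) * ψ (t + 2) i +
              ((window N t - window N (t + 1) : ℝ) : ℂ) * ψ t i) / 2 := by
          push_cast
          linear_combination ((window N (t + 1) : ℂ) / 2) * hr
        rw [he, norm_div, div_pow, Complex.norm_ofNat]
        have := norm_sq_add_le (((window N (t + 1 + 1) - window N (t + 1) : ℝ) : ℂ) * ψ (t + 2) i)
          (((window N t - window N (t + 1) : ℝ) : ℂ) * ψ t i)
        linarith
      refine (Finset.sum_le_sum fun i _ => h1 i).trans ?_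
      rw [← Finset.sum_div, Finset.sum_add_distrib]
      have ha := hsq (t + 2) _ (abs_window_succ_sub_le N (t + 1))
      have hb := hsq t (window N t - window N (t + 1))
        (by rw [abs_sub_comm]; exact abs_window_succ_sub_le N t)
      linarith
  calc _ ≤ ∑ _t : Fin (2 * N), (1 : ℝ) := Finset.sum_le_sum fun t _ => hterm t
    _ = 2 * N := by simp

end PathObservable

/-! ### The query algorithm for an expectation value, and its mean square error. -/

section Estimator

variable {I J : Type} [Fintype I] [DecidableEq I] [Fintype J] [DecidableEq J]

/-- The effect of a list of queries, to `W` or to `W†`, interleaved with fixed unitaries. -/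
noncomputable def runSteps (W : Matrix I I ℂ)
    (steps : List (Bool × Matrix.unitaryGroup (I × J) ℂ)) (Φ : I × J → ℂ) : I × J → ℂ :=
  steps.foldl (fun ψ s => s.2.1 *ᵥ (((if s.1 then Wᴴ else W) ⊗ₖ (1 : Matrix J J ℂ)) *ᵥ ψ)) Φ

/-- `R` on the register `I`, controlled by the condition `p` on the register `J`. -/
noncomputable def controlled (p : J → Prop) [DecidablePred p] (R : Matrix.unitaryGroup I ℂ) :
    Matrix.unitaryGroup (I × J) ℂ :=
  ⟨Matrix.blockDiagonal fun t => if p t then R.1 else 1,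
    blockDiagonal_mem_unitaryGroup fun _ => ite_mem_unitaryGroup R.2⟩

/-- The queries that apply `groverIterate s R W` as often as the register `J`, read by `τ`,
demands, but at most `K` times. -/
noncomputable def groverSteps (τ : J → ℕ) (S R : Matrix.unitaryGroup I ℂ) :
    ℕ → List (Bool × Matrix.unitaryGroup (I × J) ℂ)
  | 0 => [(false, controlled (fun t => 1 ≤ τ t) R)]
  | K + 1 => groverSteps τ S R K ++
      [(true, controlled (fun t => K + 1 ≤ τ t) S), (false, controlled (fun t => K + 2 ≤ τ t) R)]

theorem length_groverSteps (τ : J → ℕ) (S R : Matrix.unitaryGroup I ℂ) (K : ℕ) :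
    (groverSteps τ S R K).length = 2 * K + 1 := by
  induction K with
  | zero => rfl
  | succ K ih => simp [groverSteps, ih]; ring

/-- Induction on the number of rounds. The branch with clock value `τ` stops at `G^τ`; a branch that
still has iterates to do has already received the `R` of the next one, since that unitary shares a
step with the query to `W`. -/
theorem runSteps_groverSteps (τ : J → ℕ) (S R : Matrix.unitaryGroup I ℂ) {s : I → ℂ}
    (hS : S.1 = reflection s) {W : Matrix I I ℂ} (hW : W ∈ Matrix.unitaryGroup I ℂ)
    (a : J → ℂ) (K : ℕ) :
    runSteps W (groverSteps τ S R K) (fun z => s z.1 * a z.2) = fun z => a z.2 *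
      ((if K + 1 ≤ τ z.2 then R.1 else 1) *ᵥ
        ((groverIterate s R.1 W ^ (min K (τ z.2))) *ᵥ (W *ᵥ s))) z.1 := by
  have hW1 : W * Wᴴ = 1 := Matrix.mem_unitaryGroup_iff.1 hW
  induction K with
  | zero =>
    ext ⟨x, t⟩
    simp only [runSteps, groverSteps, List.foldl_cons, List.foldl_nil, controlled,
      Bool.false_eq_true, if_false]
    rw [blockDiagonal_mulVec]
    have : (fun y => ((W ⊗ₖ (1 : Matrix J J ℂ)) *ᵥ fun z : I × J => s z.1 * a z.2) (y, t)) =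
        a t • (W *ᵥ s) := by
      ext y
      rw [kronecker_one_mulVec, ← Matrix.mulVec_smul]
      congr 1; ext i; simp [mul_comm]
    rw [this, Matrix.mulVec_smul]
    simp
  | succ K ih =>
    rw [runSteps] at ih ⊢
    rw [groverSteps, List.foldl_append, ih]
    ext ⟨x, t⟩
    simp only [List.foldl_cons, List.foldl_nil, controlled, Bool.false_eq_true, if_false, if_true]
    rw [blockDiagonal_mulVec]
    simp only [kronecker_one_mulVec, blockDiagonal_mulVec]
    set χ := W *ᵥ s
    set G := groverIterate s R.1 W with hG
    have hsm : ∀ (M : Matrix I I ℂ) (v : I → ℂ), (M *ᵥ fun y => a t * v y) =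
        fun y => a t * (M *ᵥ v) y := fun M v => Matrix.mulVec_smul M (a t) v
    simp only [hsm]
    congr 1
    change ((if K + 2 ≤ τ t then R.1 else 1) *ᵥ (W *ᵥ ((if K + 1 ≤ τ t then S.1 else 1) *ᵥ
      (Wᴴ *ᵥ ((if K + 1 ≤ τ t then R.1 else 1) *ᵥ ((G ^ min K (τ t)) *ᵥ χ)))))) x = _
    -- The queries themselves are not controlled: in a finished branch nothing stands between `W†`
    -- and `W`, and the two cancel.
    have hcore : W *ᵥ ((if K + 1 ≤ τ t then S.1 else 1) *ᵥ
      (Wᴴ *ᵥ ((if K + 1 ≤ τ t then R.1 else 1) *ᵥ ((G ^ min K (τ t)) *ᵥ χ)))) =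
        (G ^ min (K + 1) (τ t)) *ᵥ χ := by
      by_cases h : K + 1 ≤ τ t
      · rw [if_pos h, if_pos h, min_eq_left h, min_eq_left (by omega), hS, pow_succ',
          Matrix.mulVec_mulVec, Matrix.mulVec_mulVec, Matrix.mulVec_mulVec, Matrix.mulVec_mulVec,
          hG, groverIterate]
      · rw [if_neg h, if_neg h, min_eq_right (by omega), min_eq_right (by omega),
          Matrix.one_mulVec, Matrix.one_mulVec, Matrix.mulVec_mulVec, hW1, Matrix.one_mulVec]
    rw [hcore]

theorem one_kronecker_mem_unitaryGroup {Q : Matrix J J ℂ} (hQ : Q ∈ Matrix.unitaryGroup J ℂ) :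
    (1 : Matrix I I ℂ) ⊗ₖ Q ∈ Matrix.unitaryGroup (I × J) ℂ :=
  Matrix.kronecker_mem_unitary (one_mem _) hQ

/-- The mean square error of the estimation of `⟨χ|R|χ⟩`, `χ = W s`, by the windowed superposition
of Grover iterates. -/
theorem exists_steps_sum_sub_sq_le {N : ℕ} (hN : 0 < N) (τ : J ≃ Fin (2 * N)) (i₀ : I × J)
    (s : I → ℂ) (hs : ∑ i, ‖s i‖ ^ 2 = 1) (R : Matrix.unitaryGroup I ℂ) (hR2 : R.1 * R.1 = 1) :
    ∃ (Q : Matrix.unitaryGroup (I × J) ℂ) (steps : List (Bool × Matrix.unitaryGroup (I × J) ℂ))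
      (out : J → ℝ), steps.length = 4 * N + 2 ∧ ∀ W ∈ Matrix.unitaryGroup I ℂ,
        (∑ z, ‖runSteps W steps (Q.1 *ᵥ Pi.single i₀ 1) z‖ ^ 2 = 1) ∧
        ∀ x : ℝ, star (W *ᵥ s) ⬝ᵥ (R.1 *ᵥ (W *ᵥ s)) = x →
          ∑ z, (out z.2 - x) ^ 2 * ‖runSteps W steps (Q.1 *ᵥ Pi.single i₀ 1) z‖ ^ 2 ≤
            4 / (N : ℝ) ^ 2 := by
  set Z : ℝ := ∑ t : Fin (2 * N), window N t ^ 2 with hZ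
  have hNr : (0 : ℝ) < N := by exact_mod_cast hN
  have hZle : (N : ℝ) ^ 3 / 2 ≤ Z := by
    rw [hZ, Fin.sum_univ_eq_sum_range (fun t => window N t ^ 2)]
    exact le_sum_window_sq N
  have hZpos : 0 < Z := lt_of_lt_of_le (by positivity) hZle
  set a : J → ℂ := fun j => ((window N (τ j) / Real.sqrt Z : ℝ) : ℂ) with ha
  have hanorm : ∀ j, ‖a j‖ ^ 2 = window N (τ j) ^ 2 / Z := fun j => by
    rw [ha, Complex.norm_real, Real.norm_eq_abs, sq_abs, div_pow, Real.sq_sqrt hZpos.le]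
  have hasum : ∑ j, ‖a j‖ ^ 2 = 1 := by
    simp only [hanorm]
    rw [← Finset.sum_div, Equiv.sum_comp τ (fun t : Fin (2 * N) => window N t ^ 2), ← hZ,
      div_self hZpos.ne']
  -- One initial unitary prepares the input `s` of the oracle together with the windowed clock `a`.
  obtain ⟨Q, hQ, hQv⟩ := exists_unitary_mulVec_single i₀ (fun z : I × J => s z.1 * a z.2) (by
    simp only [norm_mul, mul_pow, Fintype.sum_prod_type, ← Finset.mul_sum, hasum, mul_one, hs])
  set A : Matrix J J ℂ := (pathMatrix (2 * N)).submatrix τ τ with hA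
  have hAh : A.IsHermitian := (pathMatrix_isHermitian _).submatrix τ
  set U : Matrix J J ℂ := (hAh.eigenvectorUnitary : Matrix J J ℂ)ᴴ with hU
  have hUu : U ∈ Matrix.unitaryGroup J ℂ := Unitary.star_mem hAh.eigenvectorUnitary.2
  let S : Matrix.unitaryGroup I ℂ := ⟨reflection s, reflection_mem_unitaryGroup hs⟩
  -- The appended step serves to rotate the clock into the eigenbasis of `A`. Its query applies one
  -- more `W` to every branch alike, which affects neither the norms nor the linear recurrence; this
  -- `W` is part of `ψ` below.
  refine ⟨⟨Q, hQ⟩, groverSteps (fun j => (τ j : ℕ)) S R (2 * N) ++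
    [(false, ⟨_, one_kronecker_mem_unitaryGroup hUu⟩)], hAh.eigenvalues, ?_, ?_⟩
  · simp [length_groverSteps]; ring
  intro W hW
  set ψ : ℕ → I → ℂ := fun t => W *ᵥ ((groverIterate s R.1 W ^ t) *ᵥ (W *ᵥ s)) with hψ
  have hψn : ∀ t, ∑ i, ‖ψ t i‖ ^ 2 = 1 := fun t => by
    rw [hψ, sum_norm_sq_mulVec hW,
      sum_norm_sq_mulVec (pow_mem (groverIterate_mem_unitaryGroup hs R.2 hW) t),
      sum_norm_sq_mulVec hW, hs]
  have hrun : ∀ x j, runSteps W (groverSteps (fun j => (τ j : ℕ)) S R (2 * N) ++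
      [(false, ⟨_, one_kronecker_mem_unitaryGroup hUu⟩)]) (Q *ᵥ Pi.single i₀ 1) (x, j) =
        (U *ᵥ fun j => a j * ψ (τ j) x) j := by
    intro x j
    have h := runSteps_groverSteps (fun j => (τ j : ℕ)) S R (s := s) rfl hW a (2 * N)
    rw [runSteps] at h ⊢
    rw [List.foldl_append, hQv, h]
    simp only [List.foldl_cons, List.foldl_nil, Bool.false_eq_true, if_false]
    rw [one_kronecker_mulVec]
    congr 1
    ext j
    rw [kronecker_one_mulVec]
    -- Clock values are below `2 * N`, so after `2 * N` rounds no branch is truncated and no `R` is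
    -- pending.
    have h1 : ¬ (2 * N + 1 ≤ (τ j : ℕ)) := by have := (τ j).2; omega
    have h2 : min (2 * N) (τ j : ℕ) = τ j := min_eq_right (τ j).2.le
    simp only [h1, h2, if_false, Matrix.one_mulVec]
    exact congrFun (Matrix.mulVec_smul W (a j) _) x
  constructor
  · rw [Fintype.sum_prod_type]
    simp only [hrun]
    simp only [sum_norm_sq_mulVec hUu, norm_mul, mul_pow]
    rw [Finset.sum_comm]
    simp only [← Finset.mul_sum, hψn, mul_one, hasum]
  · intro x hx
    rw [Fintype.sum_prod_type]
    simp only [hrun]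
    have hrec : ∀ t, ψ (t + 2) + ψ t = (2 * x : ℂ) • ψ (t + 1) := fun t => by
      rw [hψ]
      simp only
      rw [← Matrix.mulVec_add, groverIterate_pow_recurrence hs hR2 hW hx, Matrix.mulVec_smul]
    simp only [hU, sum_eigenvalues_sub_sq_mul]
    have hterm : ∀ i, ∑ j, ‖(A *ᵥ fun j => a j * ψ (τ j) i) j - x * (a j * ψ (τ j) i)‖ ^ 2 =
        (∑ t : Fin (2 * N), ‖(pathMatrix (2 * N) *ᵥ fun t => (window N t : ℂ) * ψ t i) t -
          x * ((window N t : ℂ) * ψ t i)‖ ^ 2) / Z := by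
      intro i
      rw [Finset.sum_div, ← Equiv.sum_comp τ]
      refine Finset.sum_congr rfl fun j _ => ?_
      have h1 : (A *ᵥ fun j => a j * ψ (τ j) i) j = ((1 / Real.sqrt Z : ℝ) : ℂ) *
          (pathMatrix (2 * N) *ᵥ fun t => (window N t : ℂ) * ψ t i) (τ j) := by
        simp only [Matrix.mulVec, dotProduct, hA, Matrix.submatrix_apply, Finset.mul_sum]
        rw [← Equiv.sum_comp τ]
        refine Finset.sum_congr rfl fun j' _ => ?_
        rw [ha]; push_cast; ring
      have h2 : a j = ((1 / Real.sqrt Z : ℝ) : ℂ) * (window N (τ j) : ℂ) := by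
        rw [ha]; push_cast; ring
      rw [h1, h2]
      have h3 : ∀ c u w p : ℂ, c * u - x * (c * w * p) = c * (u - x * (w * p)) := by
        intros; ring
      rw [h3, norm_mul, mul_pow, Complex.norm_real, Real.norm_eq_abs, sq_abs, div_pow,
        Real.sq_sqrt hZpos.le]
      ring
    rw [Finset.sum_congr rfl fun i _ => hterm i, ← Finset.sum_div]
    have hfin := sum_pathMatrix_sub_sq_le (N := N) hψn hrec
    -- The residual of the unnormalized vector is at most `2N`, against a squared norm `Z` of at
    -- least `N³/2`.
    calc _ ≤ (2 * N : ℝ) / ((N : ℝ) ^ 3 / 2) := by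
          apply div_le_div₀ (by positivity) hfin (by positivity) hZle
      _ = 4 / (N : ℝ) ^ 2 := by field_simp; ring

end Estimator

/-! ### From mean square error to success probability. -/

open Classical in
/-- Markov's inequality for the mean square error. -/
theorem two_thirds_le_of_mean_square {Ω : Type} [Fintype Ω] (p : Ω → ℝ) (out : Ω → ℝ)
    (x δ : ℝ) (hp : ∀ z, 0 ≤ p z) (hsum : ∑ z, p z = 1) (hδ : 0 < δ)
    (hms : ∑ z, (out z - x) ^ 2 * p z ≤ δ ^ 2 / 3) :
    2 / 3 ≤ ∑ z, if |out z - x| ≤ δ then p z else 0 := by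
  have h : ∀ z, p z - (out z - x) ^ 2 * p z / δ ^ 2 ≤ if |out z - x| ≤ δ then p z else 0 := by
    intro z
    split_ifs with hz
    · have : 0 ≤ (out z - x) ^ 2 * p z / δ ^ 2 := by have := hp z; positivity
      linarith
    · have h1 : δ ^ 2 ≤ (out z - x) ^ 2 := by
        rw [← sq_abs (out z - x)]
        exact pow_le_pow_left₀ hδ.le (not_le.1 hz).le 2
      have h2 : p z ≤ (out z - x) ^ 2 * p z / δ ^ 2 := by
        rw [le_div_iff₀ (by positivity), mul_comm]
        exact mul_le_mul_of_nonneg_right h1 (hp z)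
      linarith
  refine le_trans ?_ (Finset.sum_le_sum fun z _ => h z)
  rw [Finset.sum_sub_distrib, hsum, ← Finset.sum_div]
  have : (∑ z, (out z - x) ^ 2 * p z) / δ ^ 2 ≤ 1 / 3 := by
    rw [div_le_iff₀ (by positivity)]
    linarith
  linarith

/-- Amplitude estimation: an expectation value `⟨χ|R|χ⟩` in the state `χ = W s` prepared by the
oracle is estimated to within `δ` with `O(1/δ)` queries. -/
theorem exists_queryAlgorithm_estimating {ι : Type} [Fintype ι] [DecidableEq ι]
    (s : Bits ι → ℂ) (hs : ∑ i, ‖s i‖ ^ 2 = 1) (R : Matrix (Bits ι) (Bits ι) ℂ)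
    (hR : R ∈ Matrix.unitaryGroup (Bits ι) ℂ) (hR2 : R * R = 1) (δ γ : ℝ) (hδ : 0 < δ)
    (hγ : 0 < γ) :
    ∃ A : QueryAlgorithm ι, (A.queries : ℝ) ≤ 48 / δ ∧
      ∀ W ∈ Matrix.unitaryGroup (Bits ι) ℂ, ∀ x : ℝ,
        star (W *ᵥ s) ⬝ᵥ (R *ᵥ (W *ᵥ s)) = x →
          2 / 3 ≤ A.successProb W (γ * x) (γ * δ) := by
  rcases le_or_gt 1 δ with h1 | h1
  -- For `δ ≥ 1` the answer `0` is always good enough. Making no query here is what allows a bound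
  -- without an additive constant.
  · refine ⟨⟨0, 1, [], fun _ => 0⟩, ?_, ?_⟩
    · simp only [QueryAlgorithm.queries, List.length_nil, Nat.cast_zero]; positivity
    intro W hW x hx
    have hx1 : |x| ≤ 1 := abs_le_one_of_expectation (by rw [sum_norm_sq_mulVec hW, hs]) hR hx
    have hle : |0 - γ * x| ≤ γ * δ := by
      rw [zero_sub, abs_neg, abs_mul, abs_of_pos hγ]
      exact mul_le_mul_of_nonneg_left (hx1.trans h1) hγ.le
    simp only [QueryAlgorithm.successProb, QueryAlgorithm.finalState, List.foldl_nil, hle, if_true]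
    simp only [OneMemClass.coe_one, Matrix.one_mulVec, Fintype.sum_prod_type, norm_mul, mul_pow,
      ← Finset.mul_sum]
    have hket : ∀ κ [Fintype κ] [DecidableEq κ], ∑ z : Bits κ, ‖ketZero κ z‖ ^ 2 = 1 := by
      intro κ _ _
      simp only [ketZero, apply_ite, norm_one, norm_zero]
      rw [Finset.sum_eq_single (fun _ => false)] <;> simp +contextual
    simp only [hket, mul_one]
    norm_num
  -- The path length `2N` with `N = 2^q` fills `q + 1` qubits. The lower bound gives `4/N² ≤ δ²/4 ≤
  -- δ²/3`, the upper one `4N + 2 ≤ 6N ≤ 48/δ` queries.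
  · obtain ⟨q, hq1, hq2⟩ : ∃ q : ℕ, 4 / δ ≤ (2 : ℝ) ^ q ∧ (2 : ℝ) ^ q ≤ 8 / δ := by
      obtain ⟨q, hq⟩ := exists_nat_pow_near (x := 4 / δ) (y := 2)
        (by rw [le_div_iff₀ hδ]; linarith) one_lt_two
      refine ⟨q + 1, hq.2.le, ?_⟩
      rw [pow_succ]
      have := hq.1
      have h8 : 8 / δ = 4 / δ * 2 := by ring
      rw [h8]; linarith
    have hcard : Fintype.card (Bits (Fin (q + 1))) = 2 * 2 ^ q := by
      simp [Bits, pow_succ, mul_comm]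
    obtain ⟨Q, steps, out, hlen, hW⟩ := exists_steps_sum_sub_sq_le (N := 2 ^ q) (by positivity)
      (Fintype.equivFinOfCardEq hcard) ((fun _ => false, fun _ => false)) s hs ⟨R, hR⟩ hR2
    refine ⟨⟨q + 1, Q, steps, fun z => γ * out z.2⟩, ?_, ?_⟩
    · simp only [QueryAlgorithm.queries, hlen]
      push_cast
      have : (1 : ℝ) ≤ 2 ^ q := one_le_pow₀ one_le_two
      have h48 : 48 / δ = 6 * (8 / δ) := by ring
      rw [h48]; linarith
    intro W hWu x hx
    obtain ⟨hn, hms⟩ := hW W hWu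
    have hms := hms x hx
    have hket : (fun z : Bits ι × Bits (Fin (q + 1)) =>
        ketZero ι z.1 * ketZero (Fin (q + 1)) z.2) =
        Pi.single (fun _ => false, fun _ => false) 1 := by
      ext ⟨z1, z2⟩
      simp only [ketZero, Pi.single_apply, Prod.mk.injEq]
      by_cases h1 : z1 = fun _ => false <;> by_cases h2 : z2 = fun _ => false <;> simp [h1, h2]
    have hfin : ∀ z, (⟨q + 1, Q, steps, fun z => γ * out z.2⟩ : QueryAlgorithm ι).finalState W z =
        runSteps W steps (Q.1 *ᵥ Pi.single (fun _ => false, fun _ => false) 1) z := by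
      intro z
      simp only [QueryAlgorithm.finalState, runSteps, hket]
      rfl
    simp only [QueryAlgorithm.successProb, hfin]
    refine two_thirds_le_of_mean_square _ (fun z => γ * out z.2) (γ * x) (γ * δ)
      (fun z => by positivity) hn (by positivity) ?_
    have he : ∀ z : Bits ι × Bits (Fin (q + 1)), (γ * out z.2 - γ * x) ^ 2 *
        ‖runSteps W steps (Q.1 *ᵥ Pi.single (fun _ => false, fun _ => false) 1) z‖ ^ 2 =
        γ ^ 2 * ((out z.2 - x) ^ 2 *
        ‖runSteps W steps (Q.1 *ᵥ Pi.single (fun _ => false, fun _ => false) 1) z‖ ^ 2) := by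
      intro z; ring
    rw [Finset.sum_congr rfl fun z _ => he z, ← Finset.mul_sum, mul_pow, mul_div_assoc]
    refine mul_le_mul_of_nonneg_left (hms.trans ?_) (by positivity)
    push_cast
    have h4 : 4 ≤ 2 ^ q * δ := by rwa [div_le_iff₀ hδ] at hq1
    rw [div_le_div_iff₀ (by positivity) (by norm_num), ← mul_pow, mul_comm δ]
    nlinarith

/-! ### Tensor products of one-site matrices. -/

section TensorProducts

variable {ι α : Type} [Fintype ι] [DecidableEq ι] [Fintype α] [DecidableEq α]

/-- The tensor product of the matrices `A i`. -/
noncomputable def prodMat (A : ι → Matrix α α ℂ) : Matrix (ι → α) (ι → α) ℂ :=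
  Matrix.of fun x y => ∏ i, A i (x i) (y i)

theorem prodMat_mul (A B : ι → Matrix α α ℂ) : prodMat A * prodMat B = prodMat (A * B) := by
  ext x y
  simp only [prodMat, Matrix.mul_apply, Matrix.of_apply, Pi.mul_apply, ← Finset.prod_mul_distrib]
  rw [Finset.prod_univ_sum, Fintype.piFinset_univ]

theorem prodMat_one : prodMat (1 : ι → Matrix α α ℂ) = 1 := by
  ext x y
  simp only [prodMat, Matrix.of_apply, Pi.one_apply, Matrix.one_apply]
  rw [Finset.prod_ite_zero]
  simp [funext_iff]

theorem prodMat_conjTranspose (A : ι → Matrix α α ℂ) :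
    (prodMat A)ᴴ = prodMat fun i => (A i)ᴴ := by
  ext x y
  simp [prodMat, Matrix.conjTranspose_apply]

theorem prodMat_mem_unitaryGroup {A : ι → Matrix α α ℂ}
    (hA : ∀ i, A i ∈ Matrix.unitaryGroup α ℂ) :
    prodMat A ∈ Matrix.unitaryGroup (ι → α) ℂ := by
  rw [Matrix.mem_unitaryGroup_iff, Matrix.star_eq_conjTranspose, prodMat_conjTranspose,
    prodMat_mul, ← prodMat_one]
  congr 1
  exact funext fun i => Matrix.mem_unitaryGroup_iff.1 (hA i)

/-- The operator that acts as `A` on the factor `i` and trivially on the others. -/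
theorem prodMat_update_one_apply (i : ι) (A : Matrix α α ℂ) (x y : ι → α) :
    prodMat (Function.update 1 i A) x y = if ∀ j, j ≠ i → x j = y j then A (x i) (y i) else 0 := by
  simp only [prodMat, Matrix.of_apply]
  rw [← Finset.mul_prod_erase _ _ (Finset.mem_univ i), Function.update_self]
  have : ∀ j ∈ Finset.univ.erase i, (Function.update (1 : ι → Matrix α α ℂ) i A) j (x j) (y j) =
      if x j = y j then 1 else 0 := fun j hj => by
    rw [Function.update_of_ne (Finset.ne_of_mem_erase hj), Pi.one_apply, Matrix.one_apply]
  rw [Finset.prod_congr rfl this, Finset.prod_ite_zero]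
  simp

end TensorProducts

/-! ### The Hadamard transform. -/

section Hadamard

theorem inv_sqrt_two_sq : (((1 / Real.sqrt 2 : ℝ) : ℂ)) ^ 2 = 1 / 2 := by
  rw [← Complex.ofReal_pow, div_pow, Real.sq_sqrt (by norm_num)]
  push_cast
  norm_num

theorem inv_sqrt_two_ne_zero : (((1 / Real.sqrt 2 : ℝ) : ℂ)) ≠ 0 := by
  intro h
  have := inv_sqrt_two_sq
  rw [h] at this
  norm_num at this

theorem hadamard_mul_self : hadamard * hadamard = 1 := by
  have h := inv_sqrt_two_sq
  ext a b
  rw [Matrix.mul_apply, Fintype.sum_bool]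
  simp only [hadamard, Matrix.of_apply, Matrix.one_apply]
  generalize (((1 / Real.sqrt 2 : ℝ) : ℂ)) = c at h
  cases a <;> cases b <;> simp <;> linear_combination 2 * h

theorem hadamard_conjTranspose : hadamardᴴ = hadamard := by
  ext a b
  simp only [hadamard, Matrix.conjTranspose_apply, Matrix.of_apply]
  cases a <;> cases b <;> simp

theorem hadamard_mem_unitaryGroup : hadamard ∈ Matrix.unitaryGroup Bool ℂ := by
  rw [Matrix.mem_unitaryGroup_iff, Matrix.star_eq_conjTranspose, hadamard_conjTranspose,
    hadamard_mul_self]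

variable {ι : Type} [Fintype ι] [DecidableEq ι]

theorem hadamardAll_eq_prodMat : hadamardAll ι = prodMat fun _ => hadamard := rfl

theorem hadamardAll_mul_self : hadamardAll ι * hadamardAll ι = 1 := by
  rw [hadamardAll_eq_prodMat, prodMat_mul, ← prodMat_one]
  congr 1
  exact funext fun _ => hadamard_mul_self

theorem hadamardAll_mem_unitaryGroup : hadamardAll ι ∈ Matrix.unitaryGroup (Bits ι) ℂ :=
  prodMat_mem_unitaryGroup fun _ => hadamard_mem_unitaryGroup

theorem hadamardAll_zero_right (x : Bits ι) :
    hadamardAll ι x (fun _ => false) = (((1 / Real.sqrt 2 : ℝ) : ℂ)) ^ Fintype.card ι := by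
  simp [hadamardAll, hadamard]

theorem hadamardAll_zero_left (x : Bits ι) :
    hadamardAll ι (fun _ => false) x = (((1 / Real.sqrt 2 : ℝ) : ℂ)) ^ Fintype.card ι := by
  simp [hadamardAll, hadamard]

/-- The column of `H^{⊗n}` at `|0⟩` is constant, so a row sum is an entry of `H^{⊗n} H^{⊗n} = 1` up
to that constant. -/
theorem sum_hadamardAll (x : Bits ι) :
    ∑ a, hadamardAll ι x a = (if x = fun _ => false then 1 else 0) /
      (((1 / Real.sqrt 2 : ℝ) : ℂ)) ^ Fintype.card ι := by
  rw [eq_div_iff (pow_ne_zero _ inv_sqrt_two_ne_zero), Finset.sum_mul]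
  have h := congrFun (congrFun (hadamardAll_mul_self (ι := ι)) x) (fun _ => false)
  rw [Matrix.mul_apply, Matrix.one_apply] at h
  simpa only [hadamardAll_zero_right] using h

end Hadamard

/-! ### The Bell circuit on product and maximally entangled vectors, and the resulting signal. -/

section Bell

variable {n : ℕ}

theorem bellCircuit_mulVec (f : Bits (Fin n) × Bits (Fin n) → ℂ) (x y : Bits (Fin n)) :
    (bellCircuit n *ᵥ f) (x, y) =
      ∑ a, hadamardAll (Fin n) x a * f (a, fun i => xor (y i) (a i)) := by
  rw [bellCircuit, ← Matrix.mulVec_mulVec, kronecker_one_mulVec, Matrix.mulVec, dotProduct]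
  refine Finset.sum_congr rfl fun a _ => ?_
  congr 1
  rw [Matrix.mulVec, dotProduct, Finset.sum_eq_single (a, fun i => xor (y i) (a i))]
  · rw [Matrix.of_apply, if_pos, one_mul]
    ext i <;> simp
  · rintro ⟨b, c⟩ - hne
    rw [Matrix.of_apply, if_neg, zero_mul]
    intro h
    apply hne
    simp only [Prod.mk.injEq] at h ⊢
    obtain ⟨rfl, rfl⟩ := h
    exact ⟨rfl, by ext i; simp⟩
  · simp

/-- The all-ones vector is a Bell-basis preimage of `|0⟩|+⟩`. -/
theorem bellCircuit_mulVec_one (x y : Bits (Fin n)) :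
    (bellCircuit n *ᵥ 1) (x, y) = (if x = fun _ => false then 1 else 0) /
      (((1 / Real.sqrt 2 : ℝ) : ℂ)) ^ n := by
  rw [bellCircuit_mulVec]
  simp only [Pi.one_apply, mul_one]
  rw [sum_hadamardAll, Fintype.card_fin]

/-- CNOT disentangles `∑ₐ |a,a⟩` into `∑ₐ |a⟩|0⟩`, and the Hadamard transform concentrates the front
register on `|0⟩`. -/
theorem bellCircuit_mulVec_diag (x y : Bits (Fin n)) :
    (bellCircuit n *ᵥ fun p => if p.1 = p.2 then 1 else 0) (x, y) =
      (if x = fun _ => false then 1 else 0) * (if y = fun _ => false then 1 else 0) /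
        (((1 / Real.sqrt 2 : ℝ) : ℂ)) ^ n := by
  rw [bellCircuit_mulVec]
  have h : ∀ a : Bits (Fin n), (a = fun i => xor (y i) (a i)) ↔ y = fun _ => false := by
    intro a
    simp only [funext_iff]
    refine forall_congr' fun i => ?_
    cases y i <;> cases a i <;> simp
  simp only [h]
  rw [← Finset.sum_mul, sum_hadamardAll, Fintype.card_fin]
  ring

/-- The value on `|+⟩⟨+|` of the off-diagonal block of a channel realizing `H^{⊗n} U H^{⊗n}`. -/
theorem sum_blocks_of_realizes {C : BlockChannel n} {η : ℝ} {U : Circuit (Fin n)}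
    (h : C.Realizes η (conjHadamard U)) :
    (((1 / Real.sqrt 2 : ℝ) : ℂ)) ^ (2 * n) *
      (∑ x, ∑ a, ∑ b, ∑ i, C.K i x a * star (C.L i x b)) =
        η * plusZeroAmplitude U / (((1 / Real.sqrt 2 : ℝ) : ℂ)) ^ n := by
  obtain ⟨F, hF, hη, hC⟩ := h
  set c := (((1 / Real.sqrt 2 : ℝ) : ℂ)) with hc
  have hc0 : c ^ n ≠ 0 := pow_ne_zero _ inv_sqrt_two_ne_zero
  -- This entry is all that is used of `F`: both Bell images below have their front register in
  -- `|0⟩`.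
  have hF0 : F (fun _ => false) (fun _ => false) = 1 := by
    have := congrFun hF (fun _ => false)
    simpa [ketZero, Matrix.mulVec, dotProduct] using this
  -- Taking the trace over the encoding register amounts to pairing with `∑ₓ |x,x⟩`, which exposes
  -- the encoded operator.
  have h1 : ∑ x, ∑ a, ∑ b, ∑ i, C.K i x a * star (C.L i x b) =
      star (fun p : Bits (Fin n) × Bits (Fin n) => if p.1 = p.2 then (1 : ℂ) else 0) ⬝ᵥ
        ((∑ i, C.K i ⊗ₖ (C.L i).map star) *ᵥ 1) := by
    simp only [dotProduct, Matrix.mulVec, Fintype.sum_prod_type, Matrix.sum_apply, Pi.star_apply,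
      Matrix.kroneckerMap_apply, Matrix.map_apply, Pi.one_apply, mul_one, apply_ite star, star_one,
      star_zero, ite_mul, one_mul, zero_mul, Finset.sum_ite_eq, Finset.mem_univ, if_true]
  have hV : ∑ y, conjHadamard U (fun _ => false) y = plusZeroAmplitude U / c ^ n := by
    have hsum : ∑ y, conjHadamard U (fun _ => false) y =
        (conjHadamard U *ᵥ 1) (fun _ => false) := by simp [Matrix.mulVec, dotProduct]
    have hH : hadamardAll (Fin n) *ᵥ 1 = (1 / c ^ n) • ketZero (Fin n) := by
      ext x
      have := sum_hadamardAll x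
      simp only [Fintype.card_fin, ← hc] at this
      simp only [Matrix.mulVec, dotProduct, Pi.one_apply, mul_one, this, Pi.smul_apply, ketZero,
        smul_eq_mul]
      ring
    rw [hsum, conjHadamard, ← Matrix.mulVec_mulVec, hH, ← Matrix.mulVec_mulVec, Matrix.mulVec_smul,
      Matrix.mulVec_smul, Pi.smul_apply, plusZeroAmplitude, smul_eq_mul, mul_comm, mul_one_div]
    congr 1
    simp only [Matrix.mulVec, dotProduct, hadamardAll_zero_left, ketPlus, Pi.star_apply,
      Fintype.card_fin]
    refine Finset.sum_congr rfl fun x _ => ?_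
    simp
  rw [h1, hC, Matrix.smul_mulVec, dotProduct_smul, Matrix.mul_assoc, ← Matrix.mulVec_mulVec,
    Matrix.dotProduct_mulVec, ← Matrix.star_mulVec, ← Matrix.mulVec_mulVec]
  have h2 : star (bellCircuit n *ᵥ fun p => if p.1 = p.2 then (1 : ℂ) else 0) =
      Pi.single (fun _ => false, fun _ => false) (1 / c ^ n) := by
    ext ⟨x, y⟩
    rw [Pi.star_apply, bellCircuit_mulVec_diag, ← hc, Pi.single_apply]
    by_cases hx : x = fun _ => false <;> by_cases hy : y = fun _ => false <;>
      simp [hx, hy, hc]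
  rw [h2, single_dotProduct]
  have h3 : ((F ⊗ₖ conjHadamard U) *ᵥ (bellCircuit n *ᵥ 1)) (fun _ => false, fun _ => false) =
      plusZeroAmplitude U / c ^ n / c ^ n := by
    rw [Matrix.mulVec, dotProduct, Fintype.sum_prod_type, Finset.sum_eq_single (fun _ => false)]
    · simp only [Matrix.kroneckerMap_apply, hF0, bellCircuit_mulVec_one, if_true, one_mul, ← hc]
      rw [← Finset.sum_mul, hV]
      ring
    · intro x _ hx
      simp [bellCircuit_mulVec_one, hx]
    · simp
  rw [h3, smul_eq_mul, pow_mul, pow_right_comm]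
  field_simp

end Bell

/-! ### Reading the off-diagonal block from the assistant qubit. -/

section Assistant

variable {n e : ℕ}

/-- Splitting off the environment from the wires of a purification. -/
def joinEquiv (n e : ℕ) : (Bool × Bits (Fin n)) × Bits (Fin e) ≃ Bits (Wires n e) where
  toFun p := joinBits p.1 p.2
  invFun x := ((x (.inl ()), fun i => x (.inr (.inl i))), fun j => x (.inr (.inr j)))
  left_inv _ := rfl
  right_inv x := by
    ext i
    rcases i with _ | _ | _ <;> rfl

theorem sum_bits_wires {β : Type} [AddCommMonoid β] (f : Bits (Wires n e) → β) :
    ∑ z, f z = ∑ p, ∑ s, f (joinBits p s) := by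
  rw [← Equiv.sum_comp (joinEquiv n e), Fintype.sum_prod_type]
  rfl

/-- The operator `|0⟩⟨1| ⊗ μ^* + |1⟩⟨0| ⊗ μ` on the assistant qubit. -/
noncomputable def assistantFlip (n e : ℕ) (μ : ℂ) :
    Matrix (Bits (Wires n e)) (Bits (Wires n e)) ℂ :=
  Matrix.of fun z w => if w = Function.update z (.inl ()) (!z (.inl ())) then
    (if z (.inl ()) then μ else star μ) else 0

theorem assistantFlip_mulVec (μ : ℂ) (v : Bits (Wires n e) → ℂ) (z : Bits (Wires n e)) :
    (assistantFlip n e μ *ᵥ v) z = (if z (.inl ()) then μ else star μ) *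
      v (Function.update z (.inl ()) (!z (.inl ()))) := by
  simp [assistantFlip, Matrix.mulVec, dotProduct]

theorem update_joinBits (b b' : Bool) (x : Bits (Fin n)) (s : Bits (Fin e)) :
    Function.update (joinBits (b, x) s) (.inl ()) b' = joinBits (b', x) s := by
  ext i
  rcases i with _ | _ | _ <;> rfl

theorem assistantFlip_mul_self {μ : ℂ} (hμ : μ * star μ = 1) :
    assistantFlip n e μ * assistantFlip n e μ = 1 := by
  refine Matrix.ext_iff_mulVec.2 fun v => ?_
  ext z
  rw [← Matrix.mulVec_mulVec, assistantFlip_mulVec, assistantFlip_mulVec, Matrix.one_mulVec]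
  simp only [Function.update_self, Function.update_idem, Bool.not_not, Function.update_eq_self]
  have hμ' : star μ * μ = 1 := by rw [mul_comm]; exact hμ
  cases z (.inl ()) <;> simp only [Bool.not_true, Bool.not_false, if_true, Bool.false_eq_true,
    if_false, ← mul_assoc, hμ, hμ', one_mul]

theorem assistantFlip_conjTranspose (μ : ℂ) :
    (assistantFlip n e μ)ᴴ = assistantFlip n e μ := by
  ext z w
  simp only [assistantFlip, Matrix.conjTranspose_apply, Matrix.of_apply]
  by_cases h : w = Function.update z (.inl ()) (!z (.inl ()))
  · subst h
    cases hz : z (.inl ()) <;> simp [← hz]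
  · rw [if_neg h, if_neg, star_zero]
    rintro rfl
    simp at h

theorem assistantFlip_mem_unitaryGroup {μ : ℂ} (hμ : μ * star μ = 1) :
    assistantFlip n e μ ∈ Matrix.unitaryGroup (Bits (Wires n e)) ℂ := by
  rw [Matrix.mem_unitaryGroup_iff, Matrix.star_eq_conjTranspose, assistantFlip_conjTranspose,
    assistantFlip_mul_self hμ]

/-- The state `|+⟩|+⟩^{⊗n}|0⟩^{⊗e}`. -/
noncomputable def plusState (n e : ℕ) : Bits (Wires n e) → ℂ :=
  fun z => if ∀ j, z (.inr (.inr j)) = false then ((1 / Real.sqrt 2 : ℝ) : ℂ) ^ (n + 1) else 0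

theorem sum_norm_sq_plusState (n e : ℕ) : ∑ z, ‖plusState n e z‖ ^ 2 = 1 := by
  rw [sum_bits_wires]
  have h : ∀ (p : Bool × Bits (Fin n)) (s : Bits (Fin e)), ‖plusState n e (joinBits p s)‖ ^ 2 =
      if s = fun _ => false then (1 / 2 : ℝ) ^ (n + 1) else 0 := by
    intro p s
    have hs : (∀ j, s j = false) ↔ s = fun _ => false := by rw [funext_iff]
    simp only [plusState, joinBits, Sum.elim_inr, hs]
    split_ifs
    · rw [norm_pow, ← pow_mul, mul_comm, pow_mul, Complex.norm_real, Real.norm_eq_abs, sq_abs,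
        div_pow, Real.sq_sqrt (by norm_num), one_pow]
    · simp
  simp only [h, Finset.sum_ite_eq', Finset.mem_univ, if_true]
  simp [Bits, ← pow_succ']

/-- The two halves of the sum, over assistant values `0` and `1`, contribute `μ T` and its
conjugate. -/
theorem star_dotProduct_assistantFlip_mulVec (μ : ℂ) (χ : Bits (Wires n e) → ℂ) {T : ℂ}
    (hT : ∑ x, ∑ s, χ (joinBits (false, x) s) * star (χ (joinBits (true, x) s)) = T) :
    star χ ⬝ᵥ (assistantFlip n e μ *ᵥ χ) = ((2 * (μ * T).re : ℝ) : ℂ) := by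
  have h : star χ ⬝ᵥ (assistantFlip n e μ *ᵥ χ) = μ * T + star (μ * T) := by
    rw [dotProduct, sum_bits_wires, Fintype.sum_prod_type, Fintype.sum_bool, ← hT]
    simp only [assistantFlip_mulVec, Pi.star_apply, star_mul', star_sum, star_star, Finset.mul_sum]
    congr 1 <;> refine Finset.sum_congr rfl fun x _ => Finset.sum_congr rfl fun s _ => ?_
    · have h1 : joinBits (true, x) s (.inl ()) = true := rfl
      rw [h1, if_pos rfl, update_joinBits]
      simp only [Bool.not_true]; ring
    · have h1 : joinBits (false, x) s (.inl ()) = false := rfl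
      rw [h1, update_joinBits]
      simp only [Bool.not_false, Bool.false_eq_true, if_false]; ring
  rw [h, Complex.star_def, Complex.add_conj]

/-- The channel is evaluated on `|+⟩⟨+|` of all `n + 1` qubits, whose entries are all equal to
`2^{-(n+1)}`. The entry between assistant values `0` and `1` pairs `Kᵢ` with `Lᵢ†`. -/
theorem sum_offDiagonal_of_isPurifiedBy {C : BlockChannel n}
    {W : Matrix (Bits (Wires n e)) (Bits (Wires n e)) ℂ} (hW : C.IsPurifiedBy W) :
    ∑ x, ∑ s, (W *ᵥ plusState n e) (joinBits (false, x) s) *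
        star ((W *ᵥ plusState n e) (joinBits (true, x) s)) =
      (((1 / Real.sqrt 2 : ℝ) : ℂ)) ^ (2 * n) / 2 *
        ∑ x, ∑ a, ∑ b, ∑ i, C.K i x a * star (C.L i x b) := by
  set c := (((1 / Real.sqrt 2 : ℝ) : ℂ)) with hc
  have hρ : withEnv (Matrix.of fun _ _ => c ^ (n + 1) * star (c ^ (n + 1))) =
      Matrix.vecMulVec (plusState n e) (star (plusState n e)) := by
    ext z w
    simp only [withEnv, Matrix.of_apply, Matrix.vecMulVec_apply, plusState, Pi.star_apply]
    by_cases h1 : ∀ j, z (.inr (.inr j)) = false <;>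
      by_cases h2 : ∀ j, w (.inr (.inr j)) = false <;> simp [h1, h2, hc]
  have hcc : c ^ (n + 1) * star (c ^ (n + 1)) = c ^ (2 * n) / 2 := by
    have : star c = c := by simp [hc]
    rw [star_pow, this, ← pow_add, show n + 1 + (n + 1) = 2 * n + 2 by ring, pow_add, hc,
      inv_sqrt_two_sq]
    ring
  have h := hW.2 (Matrix.of fun _ _ => c ^ (n + 1) * star (c ^ (n + 1)))
  rw [hρ, Matrix.mul_vecMulVec, Matrix.vecMulVec_mul, ← Matrix.star_mulVec] at h
  rw [Finset.mul_sum]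
  refine Finset.sum_congr rfl fun x _ => ?_
  have hx := congrFun (congrFun h (false, x)) (true, x)
  simp only [traceEnv, Matrix.of_apply, Matrix.vecMulVec_apply, Pi.star_apply] at hx
  rw [← hx, BlockChannel.apply, Matrix.sum_apply]
  have hterm : ∀ i, (blockOp (C.K i) (C.L i) * (Matrix.of fun _ _ => c ^ (n + 1) *
      star (c ^ (n + 1)) : Matrix (Bool × Bits (Fin n)) (Bool × Bits (Fin n)) ℂ) *
      (blockOp (C.K i) (C.L i))ᴴ) (false, x) (true, x) =
      ∑ a, ∑ b, c ^ (2 * n) / 2 * (C.K i x a * star (C.L i x b)) := by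
    intro i
    rw [hcc]
    simp only [Matrix.mul_apply, Matrix.of_apply, Matrix.conjTranspose_apply, blockOp,
      Fintype.sum_prod_type, Fintype.sum_bool]
    simp only [Bool.false_eq_true, Bool.true_eq_false, if_false, if_true, zero_mul, star_zero,
      mul_zero, Finset.sum_const_zero, zero_add, add_zero, Finset.sum_mul]
    rw [Finset.sum_comm]
    refine Finset.sum_congr rfl fun a _ => Finset.sum_congr rfl fun b _ => ?_
    ring
  rw [Finset.sum_congr rfl fun i _ => hterm i, Finset.mul_sum, Finset.sum_comm]
  refine Finset.sum_congr rfl fun a _ => ?_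
  rw [Finset.mul_sum, Finset.sum_comm]
  refine Finset.sum_congr rfl fun b _ => ?_
  rw [Finset.mul_sum]

end Assistant

/-- The measured expectation is `γ⁻¹` times the wanted part of the amplitude. It is estimated to
within `ε / γ` and rescaled by `γ`, which turns `48/δ` queries into `48 γ / ε`. -/
theorem exists_queryAlgorithm_plusZeroAmplitude (n k e : ℕ) {ε : ℝ} (hε : 0 < ε) {part : ℂ → ℝ}
    (hpart : part = Complex.re ∨ part = Complex.im) :
    ∃ A : QueryAlgorithm (Wires n e),
      (A.queries : ℝ) ≤ 48 * ((2 : ℝ) ^ (-((n : ℝ) - (k : ℝ)) / 2) * ε⁻¹) ∧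
      ∀ U : Circuit (Fin n),
        ∀ (C : BlockChannel n) (W : Matrix (Bits (Wires n e)) (Bits (Wires n e)) ℂ),
          C.IsPurifiedBy W →
          C.Realizes ((2 : ℝ) ^ (-(k : ℝ) / 2)) (conjHadamard U) →
            2 / 3 ≤ A.successProb W (part (plusZeroAmplitude U)) ε := by
  obtain ⟨μ, hμ, hre⟩ : ∃ μ : ℂ, μ * star μ = 1 ∧ ∀ a, (μ * a).re = part a := by
    rcases hpart with rfl | rfl
    · exact ⟨1, by simp, by simp⟩
    -- The imaginary part of `a` is the real part of `-i a`.
    · exact ⟨-Complex.I, by simp, by simp⟩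
  set γ : ℝ := (2 : ℝ) ^ (-((n : ℝ) - (k : ℝ)) / 2) with hγ
  have hγ0 : 0 < γ := by positivity
  obtain ⟨A, hA, hest⟩ := exists_queryAlgorithm_estimating (plusState n e)
    (sum_norm_sq_plusState n e) (assistantFlip n e μ) (assistantFlip_mem_unitaryGroup hμ)
    (assistantFlip_mul_self hμ) (ε / γ) γ (by positivity) hγ0
  refine ⟨A, hA.trans_eq (by field_simp), fun U C W hW hC => ?_⟩
  have hT := sum_offDiagonal_of_isPurifiedBy hW
  rw [div_mul_eq_mul_div, sum_blocks_of_realizes hC] at hT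
  have hx := star_dotProduct_assistantFlip_mulVec μ _ hT
  have hval := hest W hW.1 _ hx
  have hη : ((((2 : ℝ) ^ (-(k : ℝ) / 2) : ℝ) : ℂ)) * plusZeroAmplitude U /
      (((1 / Real.sqrt 2 : ℝ) : ℂ)) ^ n = ((γ⁻¹ : ℝ) : ℂ) * plusZeroAmplitude U := by
    rw [mul_div_right_comm]
    congr 1
    have : (2 : ℝ) ^ (-(k : ℝ) / 2) / (1 / Real.sqrt 2) ^ n = γ⁻¹ := by
      rw [one_div, inv_pow, div_inv_eq_mul, Real.sqrt_eq_rpow, ← Real.rpow_natCast,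
        ← Real.rpow_mul (by norm_num), ← Real.rpow_add (by norm_num), hγ,
        ← Real.rpow_neg (by norm_num)]
      congr 1
      ring
    rw [← this]
    push_cast
    rfl
  have hfin : γ * (2 * (μ * (((((2 : ℝ) ^ (-(k : ℝ) / 2) : ℝ) : ℂ)) * plusZeroAmplitude U /
      (((1 / Real.sqrt 2 : ℝ) : ℂ)) ^ n / 2)).re) = part (plusZeroAmplitude U) := by
    rw [hη, ← hre, show μ * (((γ⁻¹ : ℝ) : ℂ) * plusZeroAmplitude U / 2) =
      ((γ⁻¹ / 2 : ℝ) : ℂ) * (μ * plusZeroAmplitude U) by push_cast; ring, Complex.re_ofReal_mul]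
    field_simp
  rw [hfin, mul_div_cancel₀ _ hγ0.ne'] at hval
  exact hval

/-! ### Maps of computational basis labels and diagonal matrices. -/

section BasisMaps

variable {α : Type} [Fintype α] [DecidableEq α]

/-- The linear operator `|y⟩ ↦ |σ y⟩` on computational basis states. -/
noncomputable def basisMap (σ : α → α) : Matrix α α ℂ :=
  Matrix.of fun x y => if x = σ y then 1 else 0

theorem basisMap_mul (σ τ : α → α) : basisMap σ * basisMap τ = basisMap (σ ∘ τ) := by
  ext x y
  simp [basisMap, Matrix.mul_apply]

theorem basisMap_id : basisMap (id : α → α) = 1 := by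
  ext x y
  simp [basisMap, Matrix.one_apply]

theorem mul_basisMap_apply (M : Matrix α α ℂ) (σ : α → α) (x y : α) :
    (M * basisMap σ) x y = M x (σ y) := by
  simp [basisMap, Matrix.mul_apply]

theorem basisMap_conjTranspose {σ : α → α} (hσ : Function.Involutive σ) :
    (basisMap σ)ᴴ = basisMap σ := by
  ext x y
  simp only [basisMap, Matrix.conjTranspose_apply, Matrix.of_apply]
  by_cases h : y = σ x
  · rw [if_pos h, if_pos (by rw [h, hσ]), star_one]
  · rw [if_neg h, if_neg (fun h' => h (by rw [h', hσ])), star_zero]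

theorem basisMap_mul_apply {σ : α → α} (hσ : Function.Involutive σ) (M : Matrix α α ℂ) (x y : α) :
    (basisMap σ * M) x y = M (σ x) y := by
  have : ∀ z, x = σ z ↔ z = σ x := fun z => ⟨fun h => by rw [h, hσ], fun h => by rw [h, hσ]⟩
  simp [basisMap, Matrix.mul_apply, this]

theorem basisMap_mem_unitaryGroup {σ : α → α} (hσ : Function.Involutive σ) :
    basisMap σ ∈ Matrix.unitaryGroup α ℂ := by
  rw [Matrix.mem_unitaryGroup_iff, Matrix.star_eq_conjTranspose, basisMap_conjTranspose hσ,
    basisMap_mul, hσ.comp_self, basisMap_id]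

theorem diagonal_mem_unitaryGroup {d : α → ℂ} (hd : ∀ x, d x * star (d x) = 1) :
    Matrix.diagonal d ∈ Matrix.unitaryGroup α ℂ := by
  rw [Matrix.mem_unitaryGroup_iff, Matrix.star_eq_conjTranspose, Matrix.diagonal_conjTranspose,
    Matrix.diagonal_mul_diagonal, ← Matrix.diagonal_one]
  congr 1
  exact funext hd

end BasisMaps

/-! ### Unitarity of circuits, and embedding them into larger registers. -/

section Circuits

variable {ι ι' : Type} [Fintype ι] [DecidableEq ι] [Fintype ι'] [DecidableEq ι']

/-- The action of a CNOT gate on computational basis labels. -/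
def cnotMap (c t : ι) (y : Bits ι) : Bits ι := Function.update y t (xor (y t) (y c))

theorem cnotMap_involutive {c t : ι} (h : c ≠ t) : Function.Involutive (cnotMap c t) := by
  intro y
  simp [cnotMap, Function.update_of_ne h]

theorem Gate.toMatrix_CNOT {c t : ι} (h : c ≠ t) :
    (Gate.CNOT c t h).toMatrix = basisMap (cnotMap c t) := rfl

theorem Gate.toMatrix_H (i : ι) :
    (Gate.H i).toMatrix = prodMat (Function.update 1 i hadamard) := by
  ext x y
  rw [prodMat_update_one_apply]
  rfl

theorem Gate.toMatrix_mem_unitaryGroup (g : Gate ι) :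
    g.toMatrix ∈ Matrix.unitaryGroup (Bits ι) ℂ := by
  cases g with
  | H i =>
    rw [Gate.toMatrix_H]
    refine prodMat_mem_unitaryGroup fun j => ?_
    rcases eq_or_ne j i with rfl | h
    · rw [Function.update_self]; exact hadamard_mem_unitaryGroup
    · rw [Function.update_of_ne h]; exact one_mem _
  | S i =>
    refine diagonal_mem_unitaryGroup fun x => ?_
    split_ifs <;> simp
  | T i =>
    refine diagonal_mem_unitaryGroup fun x => ?_
    split_ifs
    · rw [Complex.star_def, Complex.mul_conj', mul_comm, Complex.norm_exp_ofReal_mul_I]; simp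
    · simp
  | CNOT c t h => exact basisMap_mem_unitaryGroup (cnotMap_involutive h)

theorem Circuit.toMatrix_mem_unitaryGroup (U : Circuit ι) :
    U.toMatrix ∈ Matrix.unitaryGroup (Bits ι) ℂ := by
  induction U with
  | nil => exact one_mem _
  | cons g U ih => exact mul_mem ih g.toMatrix_mem_unitaryGroup

theorem Circuit.toMatrix_append (U V : Circuit ι) :
    Circuit.toMatrix (U ++ V) = V.toMatrix * U.toMatrix := by
  induction U with
  | nil => simp [Circuit.toMatrix]
  | cons g U ih => rw [List.cons_append, Circuit.toMatrix, ih, Circuit.toMatrix, Matrix.mul_assoc]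

open Classical in
/-- The operator that acts as `M` on the wires in the range of `f` and trivially elsewhere. -/
noncomputable def embedMat (f : ι → ι') (M : Matrix (Bits ι) (Bits ι) ℂ) :
    Matrix (Bits ι') (Bits ι') ℂ :=
  Matrix.of fun x y => if ∀ j, j ∉ Set.range f → x j = y j then M (x ∘ f) (y ∘ f) else 0

variable {f : ι → ι'}

/-- Renaming the wires of a gate. -/
def Gate.map (f : ι → ι') (hf : Function.Injective f) : Gate ι → Gate ι'
  | .H i => .H (f i)
  | .S i => .S (f i)
  | .T i => .T (f i)
  | .CNOT c t h => .CNOT (f c) (f t) (hf.ne h)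

/-- Renaming the wires of a circuit. -/
def Circuit.rename (f : ι → ι') (hf : Function.Injective f) (U : Circuit ι) : Circuit ι' :=
  List.map (Gate.map f hf) U

theorem Circuit.length_rename (hf : Function.Injective f) (U : Circuit ι) :
    (U.rename f hf).length = U.length :=
  List.length_map _

theorem embedMat_diagonal (d : Bits ι → ℂ) :
    embedMat f (Matrix.diagonal d) = Matrix.diagonal fun x => d (x ∘ f) := by
  ext x y
  simp only [embedMat, Matrix.of_apply, Matrix.diagonal_apply]
  by_cases h : x = y
  · simp [h]
  · rw [if_neg h]
    split_ifs with h1 h2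
    · exfalso
      apply h
      ext j
      by_cases hj : j ∈ Set.range f
      · obtain ⟨i, rfl⟩ := hj
        exact congrFun h2 i
      · exact h1 j hj
    · rfl
    · rfl

theorem embedMat_one : embedMat f (1 : Matrix (Bits ι) (Bits ι) ℂ) = 1 := by
  rw [← Matrix.diagonal_one, embedMat_diagonal, ← Matrix.diagonal_one]

/-- In the matrix product only intermediate labels that agree with `x` off the range of `f`
contribute; these are the extensions by `x` of labels `w` on `ι`. -/
theorem embedMat_mul (hf : Function.Injective f) (M N : Matrix (Bits ι) (Bits ι) ℂ) :
    embedMat f (M * N) = embedMat f M * embedMat f N := by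
  classical
  ext x y
  rw [Matrix.mul_apply]
  have hext : ∀ w : Bits ι, Function.extend f w x ∘ f = w := fun w =>
    funext fun i => hf.extend_apply w x i
  rw [← Fintype.sum_of_injective (fun w : Bits ι => Function.extend f w x)
    (fun w w' h => by rw [← hext w, ← hext w']; exact congrArg (· ∘ f) h)
    (fun w => embedMat f M x (Function.extend f w x) * embedMat f N (Function.extend f w x) y)]
  · simp only [embedMat, Matrix.of_apply, Matrix.mul_apply, hext]
    have h1 : ∀ w : Bits ι, ∀ j, j ∉ Set.range f → x j = Function.extend f w x j :=
      fun w j hj => (Function.extend_apply' w x j hj).symm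
    have h2 : ∀ w : Bits ι, (∀ j, j ∉ Set.range f → Function.extend f w x j = y j) ↔
        ∀ j, j ∉ Set.range f → x j = y j := fun w =>
      forall_congr' fun j => forall_congr' fun hj => by rw [← h1 w j hj]
    simp only [h2, if_pos (h1 _)]
    split_ifs <;> simp
  · intro z hz
    rw [embedMat, Matrix.of_apply, if_neg, zero_mul]
    intro h
    apply hz
    refine ⟨z ∘ f, ?_⟩
    ext j
    by_cases hj : j ∈ Set.range f
    · obtain ⟨i, rfl⟩ := hj
      exact hf.extend_apply _ _ _
    · exact (Function.extend_apply' _ _ _ hj).trans (h j hj)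
  · intro w; rfl

theorem Gate.toMatrix_map (hf : Function.Injective f) (g : Gate ι) :
    (g.map f hf).toMatrix = embedMat f g.toMatrix := by
  cases g with
  | H i =>
    ext x y
    simp only [Gate.map, Gate.toMatrix, embedMat, Matrix.of_apply, Function.comp_apply]
    by_cases h : ∀ j, j ≠ f i → x j = y j
    · rw [if_pos h, if_pos, if_pos]
      · exact fun j hj => h _ (hf.ne hj)
      · exact fun j hj => h _ fun h' => hj ⟨i, h'.symm⟩
    · rw [if_neg h]
      split_ifs with h1 h2
      · exfalso
        apply h
        intro j hj
        by_cases hjr : j ∈ Set.range f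
        · obtain ⟨k, rfl⟩ := hjr
          exact h2 k fun h' => hj (by rw [h'])
        · exact h1 j hjr
      · rfl
      · rfl
  | S i => exact (embedMat_diagonal fun x => if x i then Complex.I else 1).symm
  | T i =>
    exact (embedMat_diagonal fun x =>
      if x i then Complex.exp (Complex.I * ((Real.pi / 4 : ℝ) : ℂ)) else 1).symm
  | CNOT c t hct =>
    ext x y
    simp only [Gate.map, Gate.toMatrix, embedMat, Matrix.of_apply, Function.comp_apply]
    by_cases h : x = Function.update y (f t) (xor (y (f t)) (y (f c)))
    · rw [if_pos h, if_pos, if_pos]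
      · rw [h]
        exact Function.update_comp_eq_of_injective _ hf _ _
      · intro j hj
        rw [h, Function.update_of_ne]
        rintro rfl
        exact hj ⟨t, rfl⟩
    · rw [if_neg h]
      split_ifs with h1 h2
      · exfalso
        apply h
        ext j
        by_cases hjr : j ∈ Set.range f
        · obtain ⟨k, rfl⟩ := hjr
          have := congrFun h2 k
          rw [Function.comp_apply] at this
          rw [this]
          rcases eq_or_ne k t with rfl | hk
          · simp
          · rw [Function.update_of_ne hk, Function.update_of_ne (hf.ne hk)]; rfl
        · rw [h1 j hjr, Function.update_of_ne]
          rintro rfl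
          exact hjr ⟨t, rfl⟩
      · rfl
      · rfl

theorem Circuit.toMatrix_rename (hf : Function.Injective f) (U : Circuit ι) :
    (U.rename f hf).toMatrix = embedMat f U.toMatrix := by
  induction U with
  | nil => exact embedMat_one.symm
  | cons g U ih =>
    rw [Circuit.toMatrix, embedMat_mul hf, ← ih, ← Gate.toMatrix_map hf]
    rfl

end Circuits

/-! ### The operator `∑ₛ Kₛ ⊗ Lₛ^*` of a circuit and its multiplicativity. -/

section Transfer

variable {n e e₁ e₂ : ℕ}

/-- `M` does not change the assistant qubit. -/
def PreservesAssistant (M : Matrix (Bits (Wires n e)) (Bits (Wires n e)) ℂ) : Prop :=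
  ∀ z w, z (.inl ()) ≠ w (.inl ()) → M z w = 0

/-- The Kraus operators on the encoding qubits, conditioned on the value `b` of the assistant
qubit, for the environment outcome `s`. -/
def krausOf (M : Matrix (Bits (Wires n e)) (Bits (Wires n e)) ℂ) (b : Bool) (s : Bits (Fin e)) :
    Matrix (Bits (Fin n)) (Bits (Fin n)) ℂ :=
  Matrix.of fun x y => M (joinBits (b, x) s) (joinBits (b, y) fun _ => false)

/-- The operator `∑ₛ Kₛ ⊗ Lₛ^*` implemented by a purification. -/
noncomputable def transferMat (M : Matrix (Bits (Wires n e)) (Bits (Wires n e)) ℂ) :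
    Matrix (Bits (Fin n) × Bits (Fin n)) (Bits (Fin n) × Bits (Fin n)) ℂ :=
  ∑ s, krausOf M false s ⊗ₖ (krausOf M true s).map star

theorem PreservesAssistant.mul {M N : Matrix (Bits (Wires n e)) (Bits (Wires n e)) ℂ}
    (hM : PreservesAssistant M) (hN : PreservesAssistant N) : PreservesAssistant (M * N) := by
  intro z w h
  rw [Matrix.mul_apply]
  refine Finset.sum_eq_zero fun v _ => ?_
  by_cases h1 : z (.inl ()) = v (.inl ())
  · rw [hN v w (h1 ▸ h), mul_zero]
  · rw [hM z v h1, zero_mul]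

theorem preservesAssistant_one :
    PreservesAssistant (1 : Matrix (Bits (Wires n e)) (Bits (Wires n e)) ℂ) := by
  intro z w h
  rw [Matrix.one_apply, if_neg]
  rintro rfl
  exact h rfl

theorem krausOf_apply_of_preserves {M : Matrix (Bits (Wires n e)) (Bits (Wires n e)) ℂ}
    (hM : PreservesAssistant M) (s : Bits (Fin e)) (p q : Bool × Bits (Fin n)) :
    blockOp (krausOf M false s) (krausOf M true s) p q =
      M (joinBits p s) (joinBits q fun _ => false) := by
  obtain ⟨b, x⟩ := p
  obtain ⟨b', y⟩ := q
  by_cases h : b = b'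
  · subst h
    cases b <;> simp [blockOp, krausOf]
  · rw [hM _ _ h]
    simp [blockOp, h]

/-- The columns of `M` with fresh environment are orthonormal, and `M` keeps the assistant value
`b`, so no other block enters the sum. -/
theorem sum_krausOf_conjTranspose_mul {M : Matrix (Bits (Wires n e)) (Bits (Wires n e)) ℂ}
    (hU : M ∈ Matrix.unitaryGroup (Bits (Wires n e)) ℂ) (hM : PreservesAssistant M) (b : Bool) :
    ∑ s, (krausOf M b s)ᴴ * krausOf M b s = 1 := by
  ext x y
  have h : (Mᴴ * M) (joinBits (b, x) fun _ => false) (joinBits (b, y) fun _ => false) =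
      (1 : Matrix (Bits (Fin n)) (Bits (Fin n)) ℂ) x y := by
    have h1 : Mᴴ * M = 1 := Matrix.mem_unitaryGroup_iff'.1 hU
    have h2 : joinBits (b, x) (fun _ : Fin e => false) = joinBits (b, y) (fun _ => false) ↔
        x = y := by
      refine ⟨fun h => funext fun i => congrFun h (.inr (.inl i)), fun h => by rw [h]⟩
    rw [h1, Matrix.one_apply, Matrix.one_apply]
    simp only [h2]
  rw [← h, Matrix.mul_apply, sum_bits_wires, Fintype.sum_prod_type, Finset.sum_eq_single b,
    Finset.sum_comm, Matrix.sum_apply]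
  · rfl
  · intro b' _ hb
    refine Finset.sum_eq_zero fun z _ => Finset.sum_eq_zero fun s _ => ?_
    rw [hM _ (joinBits (b, y) fun _ => false) hb, mul_zero]
  · simp

/-- A unitary preserving the assistant qubit purifies a channel of block form. -/
theorem exists_blockChannel {M : Matrix (Bits (Wires n e)) (Bits (Wires n e)) ℂ}
    (hU : M ∈ Matrix.unitaryGroup (Bits (Wires n e)) ℂ) (hM : PreservesAssistant M) :
    ∃ C : BlockChannel n, C.IsPurifiedBy M ∧
      ∑ i, C.K i ⊗ₖ (C.L i).map star = transferMat M := by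
  refine ⟨⟨Bits (Fin e), krausOf M false, krausOf M true,
    sum_krausOf_conjTranspose_mul hU hM false, sum_krausOf_conjTranspose_mul hU hM true⟩,
    ⟨hU, fun ρ => ?_⟩, rfl⟩
  ext p q
  simp only [BlockChannel.apply, traceEnv, Matrix.sum_apply, Matrix.of_apply]
  refine Finset.sum_congr rfl fun s _ => ?_
  simp only [Matrix.mul_apply, Matrix.conjTranspose_apply, krausOf_apply_of_preserves hM]
  have henv : ∀ (t : Bits (Fin e)), (∀ j, t j = false) ↔ t = fun _ => false :=
    fun t => by rw [funext_iff]
  have hw : ∀ (p q : Bool × Bits (Fin n)) (t u : Bits (Fin e)),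
      withEnv ρ (joinBits p t) (joinBits q u) =
        if t = (fun _ => false) then (if u = fun _ => false then ρ p q else 0) else 0 := by
    intro p q t u
    simp only [withEnv, joinBits, Matrix.of_apply, Sum.elim_inr, Sum.elim_inl, henv, ite_and]
    rfl
  simp only [sum_bits_wires, hw, mul_ite, mul_zero, Finset.sum_ite_eq', Finset.mem_univ, if_true]
  refine Finset.sum_congr rfl fun q' _ => ?_
  rw [Finset.sum_eq_single fun _ => false]
  · simp
  · intro u _ hu
    simp [hu]
  · simp

/-- The inclusion of wires that uses the first part of a larger environment. -/
def wiresLeft (n e₁ e₂ : ℕ) : Wires n e₁ → Wires n (e₁ + e₂) :=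
  Sum.map id (Sum.map id (Fin.castAdd e₂))

/-- The inclusion of wires that uses the last part of a larger environment. -/
def wiresRight (n e₁ e₂ : ℕ) : Wires n e₂ → Wires n (e₁ + e₂) :=
  Sum.map id (Sum.map id (Fin.natAdd e₁))

theorem wiresLeft_injective : Function.Injective (wiresLeft n e₁ e₂) :=
  Function.injective_id.sumMap (Function.injective_id.sumMap (Fin.castAdd_injective _ _))

theorem wiresRight_injective : Function.Injective (wiresRight n e₁ e₂) :=
  Function.injective_id.sumMap (Function.injective_id.sumMap (Fin.natAdd_injective _ _))

theorem joinBits_comp_wiresLeft (p : Bool × Bits (Fin n)) (s : Bits (Fin e₁))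
    (t : Bits (Fin e₂)) : joinBits p (Fin.append s t) ∘ wiresLeft n e₁ e₂ = joinBits p s := by
  ext i
  rcases i with _ | _ | _ <;> simp [joinBits, wiresLeft]

theorem joinBits_comp_wiresRight (p : Bool × Bits (Fin n)) (s : Bits (Fin e₁))
    (t : Bits (Fin e₂)) : joinBits p (Fin.append s t) ∘ wiresRight n e₁ e₂ = joinBits p t := by
  ext i
  rcases i with _ | _ | _ <;> simp [joinBits, wiresRight]

/-- The two inclusions share the assistant and encoding wires and use disjoint parts of the
environment; the other part is left untouched. -/
theorem embedMat_wiresLeft (M : Matrix (Bits (Wires n e₁)) (Bits (Wires n e₁)) ℂ)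
    (p q : Bool × Bits (Fin n)) (s s' : Bits (Fin e₁)) (t t' : Bits (Fin e₂)) :
    embedMat (wiresLeft n e₁ e₂) M (joinBits p (Fin.append s t)) (joinBits q (Fin.append s' t')) =
      if t = t' then M (joinBits p s) (joinBits q s') else 0 := by
  rw [embedMat, Matrix.of_apply, joinBits_comp_wiresLeft, joinBits_comp_wiresLeft]
  refine if_congr ⟨fun h => funext fun j => ?_, ?_⟩ rfl rfl
  · have := h (.inr (.inr (Fin.natAdd e₁ j))) (by
      rintro ⟨_ | _ | i, hi⟩ <;> simp [wiresLeft] at hi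
      have := congrArg Fin.val hi
      simp at this
      omega)
    simpa [joinBits] using this
  · rintro rfl j hj
    rcases j with _ | j | j
    · exact absurd ⟨.inl (), rfl⟩ hj
    · exact absurd ⟨.inr (.inl j), rfl⟩ hj
    · refine Fin.addCases (fun i hj => ?_) (fun i _ => ?_) j hj
      · exact absurd ⟨.inr (.inr i), rfl⟩ hj
      · simp [joinBits]

theorem embedMat_wiresRight (M : Matrix (Bits (Wires n e₂)) (Bits (Wires n e₂)) ℂ)
    (p q : Bool × Bits (Fin n)) (s s' : Bits (Fin e₁)) (t t' : Bits (Fin e₂)) :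
    embedMat (wiresRight n e₁ e₂) M (joinBits p (Fin.append s t)) (joinBits q (Fin.append s' t')) =
      if s = s' then M (joinBits p t) (joinBits q t') else 0 := by
  rw [embedMat, Matrix.of_apply, joinBits_comp_wiresRight, joinBits_comp_wiresRight]
  refine if_congr ⟨fun h => funext fun j => ?_, ?_⟩ rfl rfl
  · have := h (.inr (.inr (Fin.castAdd e₂ j))) (by
      rintro ⟨_ | _ | i, hi⟩ <;> simp [wiresRight] at hi
      have := congrArg Fin.val hi
      simp at this
      omega)
    simpa [joinBits] using this
  · rintro rfl j hj
    rcases j with _ | j | j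
    · exact absurd ⟨.inl (), rfl⟩ hj
    · exact absurd ⟨.inr (.inl j), rfl⟩ hj
    · refine Fin.addCases (fun i _ => ?_) (fun i hj => ?_) j hj
      · simp [joinBits]
      · exact absurd ⟨.inr (.inr i), rfl⟩ hj

theorem sum_bits_append {β : Type} [AddCommMonoid β] (f : Bits (Fin (e₁ + e₂)) → β) :
    ∑ s, f s = ∑ s₁, ∑ s₂, f (Fin.append s₁ s₂) := by
  rw [← Equiv.sum_comp (Fin.appendEquiv e₁ e₂), Fintype.sum_prod_type]
  rfl

theorem append_false :
    Fin.append (fun _ : Fin e₁ => false) (fun _ : Fin e₂ => false) = fun _ => false := by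
  ext j
  refine Fin.addCases (fun i => ?_) (fun i => ?_) j <;> simp

theorem PreservesAssistant.embedMat {n' e' : ℕ} {f : Wires n e → Wires n' e'}
    {M : Matrix (Bits (Wires n e)) (Bits (Wires n e)) ℂ} (hM : PreservesAssistant M)
    (hf : f (.inl ()) = .inl ()) : PreservesAssistant (embedMat f M) := by
  intro z w h
  rw [_root_.embedMat, Matrix.of_apply, hM, ite_self]
  simpa [hf] using h

theorem krausOf_embedMat_mul {M : Matrix (Bits (Wires n e₁)) (Bits (Wires n e₁)) ℂ}
    {N : Matrix (Bits (Wires n e₂)) (Bits (Wires n e₂)) ℂ} (hN : PreservesAssistant N) (b : Bool)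
    (s : Bits (Fin e₁)) (t : Bits (Fin e₂)) :
    krausOf (embedMat (wiresRight n e₁ e₂) N * embedMat (wiresLeft n e₁ e₂) M) b
      (Fin.append s t) = krausOf N b t * krausOf M b s := by
  ext x y
  rw [krausOf, Matrix.of_apply, Matrix.mul_apply, sum_bits_wires, Fintype.sum_prod_type,
    Finset.sum_eq_single b]
  · rw [Matrix.mul_apply]
    refine Finset.sum_congr rfl fun z _ => ?_
    rw [sum_bits_append]
    simp only [← append_false (e₁ := e₁) (e₂ := e₂), embedMat_wiresLeft, embedMat_wiresRight,
      ite_mul, zero_mul, mul_ite, mul_zero]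
    simp [krausOf]
  · intro b' _ hb
    refine Finset.sum_eq_zero fun z _ => Finset.sum_eq_zero fun r _ => ?_
    rw [hN.embedMat rfl _ _ (Ne.symm hb), zero_mul]
  · simp

/-- With separate environments the Kraus operators are the products `N_t M_s`, over independent `s`
and `t`. Entrywise conjugation is multiplicative, so the double sum factors. -/
theorem transferMat_embedMat_mul {M : Matrix (Bits (Wires n e₁)) (Bits (Wires n e₁)) ℂ}
    {N : Matrix (Bits (Wires n e₂)) (Bits (Wires n e₂)) ℂ} (hN : PreservesAssistant N) :
    transferMat (embedMat (wiresRight n e₁ e₂) N * embedMat (wiresLeft n e₁ e₂) M) =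
      transferMat N * transferMat M := by
  have hmap : ∀ A B : Matrix (Bits (Fin n)) (Bits (Fin n)) ℂ,
      (A * B).map star = A.map star * B.map star := by
    intro A B
    ext x y
    simp [Matrix.mul_apply]
  simp only [transferMat, sum_bits_append, krausOf_embedMat_mul hN, hmap, Matrix.mul_kronecker_mul]
  rw [Finset.sum_mul_sum, Finset.sum_comm]

end Transfer

/-! ### The Bell circuit as a unitary. -/

section Bell

/-- The two-qubit Bell circuit `U_B`. -/
noncomputable def bellPair : Matrix (Bool × Bool) (Bool × Bool) ℂ :=
  (hadamard ⊗ₖ (1 : Matrix Bool Bool ℂ)) * basisMap fun q => (q.1, xor q.2 q.1)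

theorem bellCircuit_eq (n : ℕ) : bellCircuit n =
    (hadamardAll (Fin n) ⊗ₖ (1 : Matrix (Bits (Fin n)) (Bits (Fin n)) ℂ)) *
      basisMap fun q : Bits (Fin n) × Bits (Fin n) => (q.1, fun i => xor (q.2 i) (q.1 i)) := rfl

theorem bellCircuit_mem_unitaryGroup (n : ℕ) :
    bellCircuit n ∈ Matrix.unitaryGroup (Bits (Fin n) × Bits (Fin n)) ℂ := by
  rw [bellCircuit_eq]
  refine mul_mem (Matrix.kronecker_mem_unitary hadamardAll_mem_unitaryGroup (one_mem _))
    (basisMap_mem_unitaryGroup ?_)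
  rintro ⟨x, y⟩
  simp

end Bell

/-! ### Composition of gadgets along a circuit. -/

section Implements

variable {n e e₁ e₂ : ℕ}

/-- The circuit `W` implements the encoded operator `V` with efficiency `η`. -/
def Implements (W : Circuit (Wires n e)) (η : ℝ) (V : Matrix (Bits (Fin n)) (Bits (Fin n)) ℂ) :
    Prop :=
  PreservesAssistant W.toMatrix ∧ ∃ F : Matrix (Bits (Fin n)) (Bits (Fin n)) ℂ,
    F *ᵥ ketZero (Fin n) = ketZero (Fin n) ∧
      bellCircuit n * transferMat W.toMatrix = (η : ℂ) • ((F ⊗ₖ V) * bellCircuit n)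

/-- An intertwining relation composes directly: the auxiliary operators and the encoded operators
multiply in the front and back registers separately, and so do the efficiencies. -/
theorem Implements.comp {W₁ : Circuit (Wires n e₁)} {W₂ : Circuit (Wires n e₂)} {η₁ η₂ : ℝ}
    {V₁ V₂ : Matrix (Bits (Fin n)) (Bits (Fin n)) ℂ} (h₁ : Implements W₁ η₁ V₁)
    (h₂ : Implements W₂ η₂ V₂) :
    Implements (W₁.rename (wiresLeft n e₁ e₂) wiresLeft_injective ++
      W₂.rename (wiresRight n e₁ e₂) wiresRight_injective) (η₁ * η₂) (V₂ * V₁) := by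
  obtain ⟨hp₁, F₁, hF₁, hb₁⟩ := h₁
  obtain ⟨hp₂, F₂, hF₂, hb₂⟩ := h₂
  have hmat := Circuit.toMatrix_append (W₁.rename (wiresLeft n e₁ e₂) wiresLeft_injective)
    (W₂.rename (wiresRight n e₁ e₂) wiresRight_injective)
  rw [Circuit.toMatrix_rename, Circuit.toMatrix_rename] at hmat
  refine ⟨?_, F₂ * F₁, ?_, ?_⟩
  · rw [hmat]
    exact (hp₂.embedMat rfl).mul (hp₁.embedMat rfl)
  · rw [← Matrix.mulVec_mulVec, hF₁, hF₂]
  · rw [hmat, transferMat_embedMat_mul hp₂, ← Matrix.mul_assoc, hb₂, Matrix.smul_mul,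
      Matrix.mul_assoc, hb₁, Matrix.mul_smul, smul_smul, ← Matrix.mul_assoc,
      ← Matrix.mul_kronecker_mul, Complex.ofReal_mul, mul_comm (η₁ : ℂ)]

theorem Implements.exists_blockChannel {W : Circuit (Wires n e)} {η : ℝ}
    {V : Matrix (Bits (Fin n)) (Bits (Fin n)) ℂ} (h : Implements W η V) (hη : 0 < η) :
    ∃ C : BlockChannel n, C.IsPurifiedBy W.toMatrix ∧ C.Realizes η V := by
  obtain ⟨hp, F, hF, hb⟩ := h
  obtain ⟨C, hC, hK⟩ := _root_.exists_blockChannel W.toMatrix_mem_unitaryGroup hp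
  refine ⟨C, hC, F, hF, hη, ?_⟩
  have hB : (bellCircuit n)ᴴ * bellCircuit n = 1 :=
    Matrix.mem_unitaryGroup_iff'.1 (bellCircuit_mem_unitaryGroup n)
  rw [hK, Matrix.mul_assoc, ← Matrix.mul_smul, ← hb, ← Matrix.mul_assoc, hB, Matrix.one_mul]

theorem implements_nil : Implements ([] : Circuit (Wires n 0)) 1 1 := by
  refine ⟨preservesAssistant_one, 1, Matrix.one_mulVec _, ?_⟩
  have h : transferMat (Circuit.toMatrix ([] : Circuit (Wires n 0))) = 1 := by
    have hk : ∀ b s, krausOf (1 : Matrix (Bits (Wires n 0)) (Bits (Wires n 0)) ℂ) b s = 1 := by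
      intro b s
      ext x y
      rw [krausOf, Matrix.of_apply, Matrix.one_apply, Matrix.one_apply, Subsingleton.elim s
        (fun _ => false)]
      refine if_congr ⟨fun h => funext fun i => congrFun h (.inr (.inl i)), fun h => by rw [h]⟩
        rfl rfl
    rw [Circuit.toMatrix, transferMat]
    simp only [hk, Finset.univ_unique, Finset.sum_singleton]
    rw [Matrix.map_one _ (star_zero _) (star_one _), Matrix.one_kronecker_one]
  rw [h, Matrix.one_kronecker_one]
  simp

/-- The operator encoded for a single gate. -/
noncomputable def conjHadamardGate (g : Gate (Fin n)) : Matrix (Bits (Fin n)) (Bits (Fin n)) ℂ :=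
  hadamardAll (Fin n) * g.toMatrix * hadamardAll (Fin n)

/-- The pair `H^{⊗n} H^{⊗n} = 1` is inserted between the gates, so encoding respects composition. -/
theorem conjHadamard_cons (g : Gate (Fin n)) (U : Circuit (Fin n)) :
    conjHadamard (g :: U) = conjHadamard U * conjHadamardGate g := by
  rw [conjHadamard, conjHadamard, conjHadamardGate, Circuit.toMatrix]
  have h := hadamardAll_mul_self (ι := Fin n)
  calc _ = hadamardAll (Fin n) * U.toMatrix * 1 * g.toMatrix * hadamardAll (Fin n) := by
        simp only [Matrix.mul_assoc, Matrix.one_mul]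
    _ = _ := by rw [← h]; simp only [Matrix.mul_assoc]

theorem exists_implements_of_gates {c : ℕ}
    (hgate : ∀ g : Gate (Fin n), ∃ (e : ℕ) (W : Circuit (Wires n e)), e ≤ c ∧ W.length ≤ c ∧
      Implements W (if g.isH then (2 : ℝ) ^ (-1 / 2 : ℝ) else 1) (conjHadamardGate g))
    (U : Circuit (Fin n)) : ∃ (e : ℕ) (W : Circuit (Wires n e)),
      e ≤ c * U.length ∧ W.length ≤ c * U.length ∧
        Implements W ((2 : ℝ) ^ (-(U.hadamardCount : ℝ) / 2)) (conjHadamard U) := by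
  induction U with
  | nil =>
    refine ⟨0, [], by simp, by simp, ?_⟩
    have h : conjHadamard ([] : Circuit (Fin n)) = 1 := by
      rw [conjHadamard, Circuit.toMatrix, Matrix.mul_one, hadamardAll_mul_self]
    rw [h]
    simpa [Circuit.hadamardCount] using implements_nil (n := n)
  | cons g U ih =>
    obtain ⟨e₁, W₁, he₁, hl₁, h₁⟩ := hgate g
    obtain ⟨e₂, W₂, he₂, hl₂, h₂⟩ := ih
    refine ⟨e₁ + e₂, W₁.rename (wiresLeft n e₁ e₂) wiresLeft_injective ++
      W₂.rename (wiresRight n e₁ e₂) wiresRight_injective, ?_, ?_, ?_⟩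
    rotate_left 2
    · rw [conjHadamard_cons]
      convert h₁.comp h₂ using 1
      simp only [Circuit.hadamardCount, List.countP_cons]
      split_ifs
      · rw [← Real.rpow_add (by norm_num)]
        congr 1
        push_cast
        ring
      · simp
    · rw [List.length_cons, mul_add]; omega
    · rw [List.length_append, Circuit.length_rename, Circuit.length_rename, List.length_cons,
        mul_add]
      omega

end Implements

/-! ### Qubitwise factorization over the front and back registers. -/

section TwoRegisters

variable {ι α : Type} [Fintype ι] [DecidableEq ι] [Fintype α] [DecidableEq α]

/-- The tensor product of the matrices `A i`, regarded as an operator on two registers. -/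
noncomputable def prodMatPair (A : ι → Matrix (α × α) (α × α) ℂ) :
    Matrix ((ι → α) × (ι → α)) ((ι → α) × (ι → α)) ℂ :=
  (prodMat A).submatrix (Equiv.arrowProdEquivProdArrow ι (fun _ => α) fun _ => α).symm
    (Equiv.arrowProdEquivProdArrow ι (fun _ => α) fun _ => α).symm

theorem prodMatPair_apply (A : ι → Matrix (α × α) (α × α) ℂ) (p q : (ι → α) × (ι → α)) :
    prodMatPair A p q = ∏ i, A i (p.1 i, p.2 i) (q.1 i, q.2 i) := rfl

theorem prodMatPair_mul (A B : ι → Matrix (α × α) (α × α) ℂ) :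
    prodMatPair A * prodMatPair B = prodMatPair (A * B) := by
  rw [prodMatPair, prodMatPair, Matrix.submatrix_mul_equiv, prodMat_mul]
  rfl

theorem prodMat_kronecker (A B : ι → Matrix α α ℂ) :
    prodMat A ⊗ₖ prodMat B = prodMatPair fun i => A i ⊗ₖ B i := by
  ext p q
  simp [prodMatPair_apply, prodMat, Finset.prod_mul_distrib]

theorem prodMat_update_kronecker (i : ι) (a b : Matrix α α ℂ) :
    prodMat (Function.update 1 i a) ⊗ₖ prodMat (Function.update 1 i b) =
      prodMatPair (Function.update 1 i (a ⊗ₖ b)) := by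
  rw [prodMat_kronecker]
  congr 1
  ext1 j
  rcases eq_or_ne j i with rfl | h
  · simp only [Function.update_self]
  · simp only [Function.update_of_ne h, Pi.one_apply, Matrix.one_kronecker_one]

theorem sum_prodMatPair_update {κ : Type} [Fintype κ] (i : ι) (A : κ → Matrix (α × α) (α × α) ℂ) :
    ∑ s, prodMatPair (Function.update 1 i (A s)) =
      prodMatPair (Function.update 1 i (∑ s, A s)) := by
  ext p q
  simp only [prodMatPair, Matrix.sum_apply, Matrix.submatrix_apply, prodMat_update_one_apply]
  split_ifs <;> simp

theorem smul_prodMatPair_update (i : ι) (r : ℂ) (A : Matrix (α × α) (α × α) ℂ) :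
    r • prodMatPair (Function.update 1 i A) = prodMatPair (Function.update 1 i (r • A)) := by
  ext p q
  simp only [prodMatPair, Matrix.smul_apply, Matrix.submatrix_apply, prodMat_update_one_apply]
  split_ifs <;> simp

theorem bellCircuit_eq_prodMatPair (n : ℕ) : bellCircuit n = prodMatPair fun _ => bellPair := by
  ext p q
  rw [prodMatPair_apply, bellCircuit_eq, mul_basisMap_apply]
  simp only [bellPair, mul_basisMap_apply, Matrix.kroneckerMap_apply, Finset.prod_mul_distrib,
    Matrix.one_apply, Finset.prod_ite_zero]
  simp [funext_iff]
  rfl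

theorem conj_prodMat_update (i : ι) (A : Matrix Bool Bool ℂ) :
    hadamardAll ι * prodMat (Function.update 1 i A) * hadamardAll ι =
      prodMat (Function.update 1 i (hadamard * A * hadamard)) := by
  rw [hadamardAll_eq_prodMat, prodMat_mul, prodMat_mul]
  congr 1
  ext1 j
  rcases eq_or_ne j i with rfl | h
  · simp only [Pi.mul_apply, Function.update_self]
  · simp only [Pi.mul_apply, Function.update_of_ne h, Pi.one_apply, Matrix.mul_one,
      hadamard_mul_self]

end TwoRegisters

/-! ### Gadgets acting on a single encoding qubit. -/

section OneQubit

variable {n e : ℕ}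

/-- The wires of a gadget acting on the encoding qubit `i`. -/
def wiresAt (i : Fin n) (e : ℕ) : Wires 1 e → Wires n e :=
  Sum.map id (Sum.map (fun _ => i) id)

theorem wiresAt_injective (i : Fin n) (e : ℕ) : Function.Injective (wiresAt i e) :=
  Function.injective_id.sumMap ((Function.injective_of_subsingleton _).sumMap
    Function.injective_id)

/-- The Kraus operators of a gadget acting on one encoding qubit. -/
def krausOne (M : Matrix (Bits (Wires 1 e)) (Bits (Wires 1 e)) ℂ) (b : Bool) (s : Bits (Fin e)) :
    Matrix Bool Bool ℂ :=
  Matrix.of fun x y => M (joinBits (b, fun _ => x) s) (joinBits (b, fun _ => y) fun _ => false)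

theorem krausOf_embedMat_wiresAt (i : Fin n) (M : Matrix (Bits (Wires 1 e)) (Bits (Wires 1 e)) ℂ)
    (b : Bool) (s : Bits (Fin e)) :
    krausOf (embedMat (wiresAt i e) M) b s = prodMat (Function.update 1 i (krausOne M b s)) := by
  ext x y
  rw [prodMat_update_one_apply, krausOf, Matrix.of_apply, embedMat, Matrix.of_apply, krausOne,
    Matrix.of_apply]
  have hc : ∀ (x : Bits (Fin n)) (s : Bits (Fin e)),
      joinBits (b, x) s ∘ wiresAt i e = joinBits (b, fun _ => x i) s := by
    intro x s
    ext j
    rcases j with _ | _ | _ <;> rfl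
  rw [hc, hc]
  have hiff : (∀ j, j ∉ Set.range (wiresAt i e) → joinBits (b, x) s j =
      joinBits (b, y) (fun _ => false) j) ↔ ∀ j, j ≠ i → x j = y j := by
    refine ⟨fun h j hj => h (.inr (.inl j)) ?_, fun h j hj => ?_⟩
    · rintro ⟨_ | _ | _, hk⟩ <;> simp [wiresAt] at hk
      exact hj hk.symm
    rcases j with _ | j | j
    · exact absurd ⟨.inl (), rfl⟩ hj
    · refine h j ?_
      rintro rfl
      exact hj ⟨.inr (.inl 0), rfl⟩
    · exact absurd ⟨.inr (.inr j), rfl⟩ hj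
  by_cases h : ∀ j, j ≠ i → x j = y j
  · rw [if_pos h, if_pos (hiff.2 h)]
  · rw [if_neg h, if_neg (mt hiff.1 h)]

/-- A gadget on one encoding qubit is verified locally. -/
theorem implements_rename_wiresAt (i : Fin n) {W : Circuit (Wires 1 e)} {η : ℝ}
    {v f : Matrix Bool Bool ℂ} (hW : PreservesAssistant W.toMatrix)
    (hf₀ : f false false = 1) (hf₁ : f true false = 0)
    (h : bellPair * ∑ s, krausOne W.toMatrix false s ⊗ₖ (krausOne W.toMatrix true s).map star =
      (η : ℂ) • ((f ⊗ₖ v) * bellPair)) :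
    Implements (W.rename (wiresAt i e) (wiresAt_injective i e)) η
      (prodMat (Function.update 1 i v)) := by
  have hmap : ∀ A : Matrix Bool Bool ℂ, (prodMat (Function.update 1 i A)).map star =
      prodMat (Function.update 1 i (A.map star)) := by
    intro A
    ext x y
    rw [Matrix.map_apply, prodMat_update_one_apply, prodMat_update_one_apply]
    split_ifs <;> simp
  rw [Implements, Circuit.toMatrix_rename]
  refine ⟨hW.embedMat rfl, prodMat (Function.update 1 i f), ?_, ?_⟩
  · ext x
    simp only [Matrix.mulVec, dotProduct, ketZero, mul_ite, mul_one, mul_zero, Finset.sum_ite_eq',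
      Finset.mem_univ, if_true, prodMat_update_one_apply]
    by_cases hx : x = fun _ => false
    · simp [hx, hf₀]
    · rw [if_neg hx]
      split_ifs with h1
      · have : x i = true := by
          by_contra hne
          apply hx
          ext j
          rcases eq_or_ne j i with rfl | hj
          · simpa using hne
          · exact h1 j hj
        rw [this, hf₁]
      · rfl
  · simp only [transferMat, krausOf_embedMat_wiresAt, hmap, prodMat_update_kronecker]
    -- Both sides are now products over qubits; away from `i` each factor is one Bell circuit, and
    -- at `i` the claim is `h`.
    rw [sum_prodMatPair_update, bellCircuit_eq_prodMatPair, prodMatPair_mul, ← Matrix.smul_mul,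
      smul_prodMatPair_update, prodMatPair_mul]
    congr 1
    ext1 j
    rcases eq_or_ne j i with rfl | hj
    · simp only [Pi.mul_apply, Function.update_self]
      rw [h, Matrix.smul_mul]
    · simp only [Pi.mul_apply, Function.update_of_ne hj, Pi.one_apply, Matrix.mul_one,
        Matrix.one_mul]

end OneQubit

/-! ### Doubly controlled `Z` and Toffoli from the gate set. -/

section Gadgets

variable {ι : Type} [Fintype ι] [DecidableEq ι]

theorem basisMap_mul_diagonal_mul {τ : Bits ι → Bits ι} (hτ : Function.Involutive τ)
    (d : Bits ι → ℂ) :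
    basisMap τ * Matrix.diagonal d * basisMap τ = Matrix.diagonal (d ∘ τ) := by
  ext x y
  rw [mul_basisMap_apply, basisMap_mul_apply hτ, Matrix.diagonal_apply, Matrix.diagonal_apply]
  simp only [hτ.injective.eq_iff]
  rfl

theorem Gate.toMatrix_H_apply (i : ι) (x y : Bits ι) :
    (Gate.H i).toMatrix x y = if ∀ j, j ≠ i → x j = y j then hadamard (x i) (y i) else 0 := rfl

theorem mul_H_apply (N : Matrix (Bits ι) (Bits ι) ℂ) (i : ι) (x y : Bits ι) :
    (N * (Gate.H i).toMatrix) x y =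
      ∑ b, N x (Function.update y i b) * hadamard b (y i) := by
  rw [Matrix.mul_apply]
  symm
  refine Fintype.sum_of_injective (fun b => Function.update y i b)
    (Function.update_injective y i) _ _ (fun z hz => ?_) (fun b => ?_)
  · rw [Gate.toMatrix_H_apply, if_neg, mul_zero]
    intro h
    refine hz ⟨z i, ?_⟩
    ext j
    rcases eq_or_ne j i with rfl | hj
    · simp
    · simp [Function.update_of_ne hj, h j hj]
  · rw [Gate.toMatrix_H_apply, if_pos, Function.update_self]
    intro j hj
    rw [Function.update_of_ne hj]

theorem mul_CNOT_apply (N : Matrix (Bits ι) (Bits ι) ℂ) {c t : ι} (h : c ≠ t) (x y : Bits ι) :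
    (N * (Gate.CNOT c t h).toMatrix) x y = N x (cnotMap c t y) :=
  mul_basisMap_apply N (cnotMap c t) x y

theorem H_mul_diagonal_mul_H_apply (d : Bits ι → ℂ) (i : ι) (x y : Bits ι) :
    ((Gate.H i).toMatrix * Matrix.diagonal d * (Gate.H i).toMatrix) x y =
      if ∀ j, j ≠ i → x j = y j then
        ∑ b, hadamard (x i) b * d (Function.update y i b) * hadamard b (y i) else 0 := by
  rw [mul_H_apply]
  have h : ∀ b, (∀ j, j ≠ i → x j = Function.update y i b j) ↔ ∀ j, j ≠ i → x j = y j := fun b =>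
    forall_congr' fun j => forall_congr' fun hj => by rw [Function.update_of_ne hj]
  simp only [Matrix.mul_diagonal, Gate.toMatrix_H_apply, h, Function.update_self]
  split_ifs <;> simp

/-- The primitive eighth root of unity `e^{iπ/4}`. -/
noncomputable def eighthRoot : ℂ := Complex.exp (Complex.I * ((Real.pi / 4 : ℝ) : ℂ))

theorem eighthRoot_sq : eighthRoot ^ 2 = Complex.I := by
  rw [eighthRoot, ← Complex.exp_nat_mul, show ((2 : ℕ) : ℂ) * (Complex.I * ((Real.pi / 4 : ℝ) : ℂ))
    = Real.pi / 2 * Complex.I by push_cast; ring]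
  exact Complex.exp_pi_div_two_mul_I

theorem eighthRoot_pow_four : eighthRoot ^ 4 = -1 := by
  rw [show 4 = 2 * 2 by norm_num, pow_mul, eighthRoot_sq, Complex.I_sq]

theorem toMatrix_replicate {g : Gate ι} {i : ι} {w : ℂ}
    (hg : g.toMatrix = Matrix.diagonal fun z => if z i then w else 1) (k : ℕ) :
    Circuit.toMatrix (List.replicate k g) = Matrix.diagonal fun z => if z i then w ^ k else 1 := by
  induction k with
  | zero => simp [Circuit.toMatrix]
  | succ k ih =>
    rw [List.replicate_succ, Circuit.toMatrix, ih, hg, Matrix.diagonal_mul_diagonal]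
    congr 1
    ext z
    split_ifs
    · rw [pow_succ]
    · rw [one_mul]

/-- Conjugation of a circuit by a CNOT gate. -/
def cnotConj {c t : ι} (h : c ≠ t) (U : Circuit ι) : Circuit ι :=
  Gate.CNOT c t h :: (U ++ [Gate.CNOT c t h])

theorem toMatrix_cnotConj {c t : ι} (h : c ≠ t) {U : Circuit ι} {d : Bits ι → ℂ}
    (hU : U.toMatrix = Matrix.diagonal d) :
    (cnotConj h U).toMatrix = Matrix.diagonal (d ∘ cnotMap c t) := by
  rw [cnotConj, Circuit.toMatrix, Circuit.toMatrix_append, hU, Circuit.toMatrix, Circuit.toMatrix,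
    Matrix.one_mul, Gate.toMatrix_CNOT, basisMap_mul_diagonal_mul (cnotMap_involutive h)]

/-- The doubly controlled `Z` gate as a circuit. -/
def ccz {a b t : ι} (hab : a ≠ b) (hat : a ≠ t) (hbt : b ≠ t) : Circuit ι :=
  [Gate.T a] ++ ([Gate.T b] ++ ([Gate.T t] ++ (cnotConj hab (List.replicate 7 (Gate.T b)) ++
    (cnotConj hat (List.replicate 7 (Gate.T t)) ++ (cnotConj hbt (List.replicate 7 (Gate.T t)) ++
      cnotConj hat (cnotConj hbt [Gate.T t]))))))

/-- With `ω = e^{iπ/4}` and `ω⁴ = -1`, the phase is `ω^{4abt}`, where `4abt = a + b + t - (a⊕b) -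
(a⊕t) - (b⊕t) + (a⊕b⊕t)`. Each parity phase is a `T` conjugated by CNOTs, with `T⁷ = T⁻¹` for the
minus signs. -/
theorem toMatrix_ccz {a b t : ι} (hab : a ≠ b) (hat : a ≠ t) (hbt : b ≠ t) :
    (ccz hab hat hbt).toMatrix =
      Matrix.diagonal fun z => if z a && z b && z t then -1 else 1 := by
  have hT : ∀ i : ι, (Gate.T i).toMatrix =
      Matrix.diagonal fun z => if z i then eighthRoot else 1 := fun i => rfl
  have h1 : ∀ i : ι, Circuit.toMatrix [Gate.T i] =
      Matrix.diagonal fun z => if z i then eighthRoot else 1 := fun i => by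
    rw [Circuit.toMatrix, Circuit.toMatrix, Matrix.one_mul, hT]
  have h7 := fun i : ι => toMatrix_replicate (hT i) 7
  simp only [ccz, Circuit.toMatrix_append, h1, toMatrix_cnotConj _ (h7 _),
    toMatrix_cnotConj _ (toMatrix_cnotConj _ (h1 _)), Matrix.diagonal_mul_diagonal]
  congr 1
  ext z
  have h4 := eighthRoot_pow_four
  have h8 : eighthRoot ^ 8 = 1 := by rw [show 8 = 4 * 2 by norm_num, pow_mul, h4]; norm_num
  simp only [Function.comp_apply, cnotMap, Function.update_self, Function.update_of_ne hbt]
  cases z a <;> cases z b <;> cases z t <;> simp <;>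
    first
      | linear_combination (eighthRoot ^ 8 + 1) * h8
      | linear_combination h8
      | linear_combination h4

/-- The action of a Toffoli gate on computational basis labels. -/
def toffoliMap (a b t : ι) (y : Bits ι) : Bits ι :=
  Function.update y t (xor (y t) (y a && y b))

theorem toffoliMap_involutive {a b t : ι} (hat : a ≠ t) (hbt : b ≠ t) :
    Function.Involutive (toffoliMap a b t) := by
  intro y
  simp [toffoliMap, Function.update_of_ne hat, Function.update_of_ne hbt]

theorem H_mul_ccz_mul_H {a b t : ι} (hab : a ≠ b) (hat : a ≠ t) (hbt : b ≠ t) :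
    (Gate.H t).toMatrix * (ccz hab hat hbt).toMatrix * (Gate.H t).toMatrix =
      basisMap (toffoliMap a b t) := by
  ext x y
  rw [toMatrix_ccz, H_mul_diagonal_mul_H_apply]
  simp only [Function.update_of_ne hat, Function.update_of_ne hbt, Function.update_self]
  have hiff : x = toffoliMap a b t y ↔
      (∀ j, j ≠ t → x j = y j) ∧ x t = xor (y t) (y a && y b) := by
    rw [toffoliMap, Function.eq_update_iff, and_comm]
  rw [basisMap, Matrix.of_apply]
  by_cases h : ∀ j, j ≠ t → x j = y j
  · have hif : (if x = toffoliMap a b t y then (1 : ℂ) else 0) =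
        if x t = xor (y t) (y a && y b) then 1 else 0 :=
      if_congr (hiff.trans (and_iff_right h)) rfl rfl
    rw [if_pos h, hif, Fintype.sum_bool]
    have hc := inv_sqrt_two_sq
    simp only [hadamard, Matrix.of_apply]
    generalize (((1 / Real.sqrt 2 : ℝ) : ℂ)) = c at hc
    cases x t <;> cases y t <;> cases y a <;> cases y b <;> simp <;> linear_combination 2 * hc
  · rw [if_neg h, if_neg fun h' => h (hiff.1 h').1]

end Gadgets

/-! ### Gates that leave the assistant qubit unchanged. -/

section Preserves

variable {n e : ℕ}

theorem preservesAssistant_diagonal (d : Bits (Wires n e) → ℂ) :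
    PreservesAssistant (Matrix.diagonal d) := by
  intro z w h
  rw [Matrix.diagonal_apply_ne]
  rintro rfl
  exact h rfl

theorem preservesAssistant_H (i : Fin n ⊕ Fin e) :
    PreservesAssistant (Gate.toMatrix (.H (.inr i) : Gate (Wires n e))) := by
  intro z w h
  rw [Gate.toMatrix_H_apply, if_neg]
  exact fun h' => h (h' _ (by simp))

theorem preservesAssistant_CNOT {c : Wires n e} {i : Fin n ⊕ Fin e} (hc : c ≠ .inr i) :
    PreservesAssistant (Gate.CNOT c (.inr i) hc).toMatrix := by
  intro z w h
  rw [Gate.toMatrix_CNOT, basisMap, Matrix.of_apply, if_neg]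
  rintro rfl
  simp [cnotMap] at h

end Preserves

/-! ### The gadget for `S` and `T`. -/

section PhaseGadget

theorem joinBits_eq_iff_env {e : ℕ} (b x y : Bool) (s : Bits (Fin e)) :
    (∀ j, j ≠ (.inr (.inl 0) : Wires 1 e) →
      joinBits (b, fun _ => x) s j = joinBits (b, fun _ => y) (fun _ => false) j) ↔
        s = fun _ => false := by
  refine ⟨fun h => funext fun j => h (.inr (.inr j)) (by simp), fun h j hj => ?_⟩
  rcases j with _ | j | j
  · rfl
  · exact absurd (by rw [Subsingleton.elim j 0]) hj
  · exact congrFun h j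

theorem update_joinBits_qubit {e : ℕ} (b x x' : Bool) (s : Bits (Fin e)) :
    Function.update (joinBits (b, fun _ : Fin 1 => x) s) (.inr (.inl 0)) x' =
      joinBits (b, fun _ => x') s := by
  ext j
  rcases j with _ | j | j
  · rfl
  · rw [Subsingleton.elim j 0, Function.update_self]; rfl
  · rfl

/-- The gadget for a diagonal one-qubit gate; `P` is a circuit for the inverse gate on the
environment qubit. -/
def phaseGadget (P : Circuit (Wires 1 1)) : Circuit (Wires 1 1) :=
  [.H (.inr (.inl 0))] ++ ([.H (.inr (.inr 0))] ++
    (ccz (a := .inl ()) (b := .inr (.inl 0)) (t := .inr (.inr 0)) (by simp) (by simp) (by simp) ++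
      ([.H (.inr (.inr 0))] ++ (P ++ ([.H (.inr (.inr 0))] ++
    (ccz (a := .inl ()) (b := .inr (.inl 0)) (t := .inr (.inr 0)) (by simp) (by simp) (by simp) ++
      ([.H (.inr (.inr 0))] ++ [.H (.inr (.inl 0))])))))))

variable {P : Circuit (Wires 1 1)} {d : ℂ}

theorem toMatrix_singleton {ι : Type} [Fintype ι] [DecidableEq ι] (g : Gate ι) :
    Circuit.toMatrix [g] = g.toMatrix := by
  rw [Circuit.toMatrix, Circuit.toMatrix, Matrix.one_mul]

/-- A Toffoli writes the conjunction of assistant and encoding qubit into the environment qubit, `P`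
acts there, and the second Toffoli uncomputes it. This yields a controlled phase. -/
theorem toMatrix_phaseGadget
    (hP : P.toMatrix = Matrix.diagonal fun z => if z (.inr (.inr 0)) then star d else 1) :
    (phaseGadget P).toMatrix = (Gate.H (.inr (.inl 0))).toMatrix *
      Matrix.diagonal (fun z : Bits (Wires 1 1) =>
        if xor (z (.inr (.inr 0))) (z (.inl ()) && z (.inr (.inl 0))) then star d else 1) *
      (Gate.H (.inr (.inl 0))).toMatrix := by
  have ht := H_mul_ccz_mul_H (ι := Wires 1 1) (a := .inl ()) (b := .inr (.inl 0))
    (t := .inr (.inr 0)) (by simp) (by simp) (by simp)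
  have hτ := toffoliMap_involutive (ι := Wires 1 1) (a := .inl ()) (b := .inr (.inl 0))
    (t := .inr (.inr 0)) (by simp) (by simp)
  have hd := basisMap_mul_diagonal_mul hτ
    (fun z : Bits (Wires 1 1) => if z (.inr (.inr 0)) then star d else 1)
  have hcomp : ((fun z : Bits (Wires 1 1) => if z (.inr (.inr 0)) then star d else 1) ∘
      toffoliMap (.inl ()) (.inr (.inl 0)) (.inr (.inr 0))) = fun z : Bits (Wires 1 1) =>
        if xor (z (.inr (.inr 0))) (z (.inl ()) && z (.inr (.inl 0))) then star d else 1 := by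
    ext z
    simp [toffoliMap]
  rw [hcomp, ← ht] at hd
  simp only [phaseGadget, Circuit.toMatrix_append, toMatrix_singleton, hP]
  rw [← hd]
  simp only [Matrix.mul_assoc]

theorem preservesAssistant_phaseGadget
    (hP : P.toMatrix = Matrix.diagonal fun z => if z (.inr (.inr 0)) then star d else 1) :
    PreservesAssistant (phaseGadget P).toMatrix := by
  rw [toMatrix_phaseGadget hP]
  exact ((preservesAssistant_H _).mul (preservesAssistant_diagonal _)).mul (preservesAssistant_H _)

theorem krausOne_phaseGadget
    (hP : P.toMatrix = Matrix.diagonal fun z => if z (.inr (.inr 0)) then star d else 1)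
    (b : Bool) (s : Bits (Fin 1)) :
    krausOne (phaseGadget P).toMatrix b s = if s = fun _ => false then
      hadamard * Matrix.diagonal (fun x => if b && x then star d else 1) * hadamard else 0 := by
  ext x y
  rw [krausOne, Matrix.of_apply, toMatrix_phaseGadget hP, H_mul_diagonal_mul_H_apply]
  have hiff := joinBits_eq_iff_env b x y s
  by_cases hs : s = fun _ => false
  · rw [if_pos (hiff.2 hs), if_pos hs, Matrix.mul_apply]
    refine Finset.sum_congr rfl fun u _ => ?_
    rw [update_joinBits_qubit, Matrix.mul_diagonal]
    simp [joinBits]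
  · rw [if_neg (mt hiff.1 hs), if_neg hs]
    rfl

/-- Only the environment outcome `0` occurs, with `K = 1` and `L = H diag(1, d^*) H`, so `K ⊗ L^* =
1 ⊗ H diag(1, d) H`. This is a function of `X` on the target of the Bell CNOT and commutes with the
Bell circuit; hence the trivial `f` and efficiency one. -/
theorem implements_phaseGadget {n : ℕ} (i : Fin n)
    (hP : P.toMatrix = Matrix.diagonal fun z => if z (.inr (.inr 0)) then star d else 1) :
    Implements ((phaseGadget P).rename (wiresAt i 1) (wiresAt_injective i 1)) 1
      (prodMat (Function.update 1 i
        (hadamard * Matrix.diagonal (fun x => if x then d else 1) * hadamard))) := by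
  refine implements_rename_wiresAt i (f := 1) (preservesAssistant_phaseGadget hP) rfl rfl ?_
  simp only [krausOne_phaseGadget hP]
  have hk : ∀ s : Bits (Fin 1), s ∈ Finset.univ → s ≠ (fun _ => false) →
      (if s = fun _ => false then hadamard * Matrix.diagonal (fun x => if false && x then star d
        else 1) * hadamard else 0) ⊗ₖ
      (if s = fun _ => false then hadamard * Matrix.diagonal (fun x => if true && x then star d
        else 1) * hadamard else 0).map star = 0 := by
    intro s _ hs
    rw [if_neg hs, Matrix.zero_kronecker]
  rw [Finset.sum_eq_single (fun _ => false) hk (by simp), if_pos rfl, if_pos rfl,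
    Complex.ofReal_one, one_smul]
  have h1 : hadamard * Matrix.diagonal (fun x => if false && x then star d else 1) * hadamard =
      1 := by
    simp [hadamard_mul_self]
  have h2 : (hadamard * Matrix.diagonal (fun x => if true && x then star d else 1) *
      hadamard).map star = hadamard * Matrix.diagonal (fun x => if x then d else 1) * hadamard := by
    ext x y
    have hh : ∀ a b, star (hadamard a b) = hadamard a b := by
      intro a b
      simp only [hadamard, Matrix.of_apply]
      cases a <;> cases b <;> simp
    simp only [Matrix.map_apply, Matrix.mul_apply, Matrix.diagonal_apply, Fintype.sum_bool,
      star_add, star_mul', hh]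
    simp
  rw [h1, h2]
  ext ⟨x, x'⟩ ⟨y, y'⟩
  simp only [bellPair, Matrix.mul_apply, Fintype.sum_prod_type,
    Fintype.sum_bool, Matrix.kroneckerMap_apply, Matrix.one_apply, Matrix.diagonal_apply,
    basisMap, Matrix.of_apply, hadamard]
  cases x <;> cases x' <;> cases y <;> cases y' <;> simp <;> ring

end PhaseGadget

/-! ### The gadget for the Hadamard gate. -/

section HadamardGadget

/-- The gadget for the Hadamard gate. -/
def hadamardGadget : Circuit (Wires 1 2) :=
  [.H (.inr (.inl 0))] ++ ([.CNOT (.inr (.inl 0)) (.inr (.inr 0)) (by simp)] ++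
    ([.H (.inr (.inr 1))] ++
      (ccz (a := .inl ()) (b := .inr (.inr 0)) (t := .inr (.inr 1)) (by simp) (by simp) (by simp) ++
        ([.CNOT (.inr (.inr 0)) (.inr (.inl 0)) (by simp)] ++
          ([.CNOT (.inr (.inr 1)) (.inr (.inl 0)) (by simp)] ++ [.H (.inr (.inl 0))])))))

theorem preservesAssistant_hadamardGadget : PreservesAssistant hadamardGadget.toMatrix := by
  simp only [hadamardGadget, Circuit.toMatrix_append, toMatrix_singleton]
  rw [toMatrix_ccz]
  exact ((((((preservesAssistant_H _).mul (preservesAssistant_CNOT _)).mul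
    (preservesAssistant_CNOT _)).mul (preservesAssistant_diagonal _)).mul
      (preservesAssistant_H _)).mul (preservesAssistant_CNOT _)).mul (preservesAssistant_H _)

theorem joinBits_update_env_zero (b x s t s' : Bool) :
    Function.update (joinBits (b, fun _ : Fin 1 => x) ![s, t]) (.inr (.inr 0)) s' =
      joinBits (b, fun _ => x) ![s', t] := by
  ext j
  rcases j with _ | j | j
  · rfl
  · rfl
  · fin_cases j <;> rfl

theorem joinBits_update_env_one (b x s t t' : Bool) :
    Function.update (joinBits (b, fun _ : Fin 1 => x) ![s, t]) (.inr (.inr 1)) t' =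
      joinBits (b, fun _ => x) ![s, t'] := by
  ext j
  rcases j with _ | j | j
  · rfl
  · rfl
  · fin_cases j <;> rfl

/-- In the `X` basis the gadget copies the input `s` to the environment, replaces it by a uniformly
superposed `t` kept in the other environment qubit, and applies the sign `(-1)^{st}` when the
assistant is `1`. -/
theorem krausOne_hadamardGadget (b s t : Bool) :
    krausOne hadamardGadget.toMatrix b ![s, t] = Matrix.of fun x y =>
      hadamard x t * hadamard t false * (if b && s && t then -1 else 1) * hadamard s y := by
  ext x y
  have h0 : (fun _ : Fin 2 => false) = ![false, false] := by ext j; fin_cases j <;> rfl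
  rw [krausOne, Matrix.of_apply, h0]
  simp only [hadamardGadget, Circuit.toMatrix_append, toMatrix_singleton]
  rw [mul_H_apply]
  have hstep : ∀ u : Bool, ((((((Gate.toMatrix (ι := Wires 1 2) (.H (.inr (.inl 0))) *
      Gate.toMatrix (ι := Wires 1 2) (.CNOT (.inr (.inr 1)) (.inr (.inl 0)) (by simp))) *
      Gate.toMatrix (ι := Wires 1 2) (.CNOT (.inr (.inr 0)) (.inr (.inl 0)) (by simp))) *
      (ccz (ι := Wires 1 2) (a := .inl ()) (b := .inr (.inr 0)) (t := .inr (.inr 1)) (by simp)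
        (by simp) (by simp)).toMatrix) * Gate.toMatrix (ι := Wires 1 2) (.H (.inr (.inr 1)))) *
      Gate.toMatrix (ι := Wires 1 2) (.CNOT (.inr (.inl 0)) (.inr (.inr 0)) (by simp)))
        (joinBits (b, fun _ => x) ![s, t]) (joinBits (b, fun _ => u) ![false, false])) =
      if s = u then hadamard x t * (if b && u && t then -1 else 1) * hadamard t false else 0 := by
    intro u
    rw [mul_CNOT_apply, mul_H_apply]
    have e1 : cnotMap (.inr (.inl 0)) (.inr (.inr 0)) (joinBits (b, fun _ : Fin 1 => u)
        ![false, false]) = joinBits (b, fun _ => u) ![u, false] := by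
      rw [cnotMap, joinBits_update_env_zero]
      simp [joinBits]
    have e2 : ∀ w, cnotMap (.inr (.inr 1)) (.inr (.inl 0)) (cnotMap (.inr (.inr 0)) (.inr (.inl 0))
        (joinBits (b, fun _ : Fin 1 => u) ![u, w])) = joinBits (b, fun _ => w) ![u, w] := by
      intro w
      rw [cnotMap, cnotMap, update_joinBits_qubit, update_joinBits_qubit]
      simp [joinBits]
    rw [e1, toMatrix_ccz]
    simp only [joinBits_update_env_one, Matrix.mul_diagonal, mul_CNOT_apply, e2,
      Gate.toMatrix_H_apply]
    have e3 : ∀ w, (∀ j, j ≠ (.inr (.inl 0) : Wires 1 2) → joinBits (b, fun _ => x) ![s, t] j =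
        joinBits (b, fun _ => w) ![u, w] j) ↔ s = u ∧ t = w := by
      intro w
      refine ⟨fun h => ⟨h (.inr (.inr 0)) (by simp), h (.inr (.inr 1)) (by simp)⟩, ?_⟩
      rintro ⟨rfl, rfl⟩ j hj
      rcases j with _ | j | j
      · rfl
      · exact absurd (by rw [Subsingleton.elim j 0]) hj
      · rfl
    simp only [e3]
    by_cases hs : s = u
    · subst hs
      rw [if_pos rfl, Finset.sum_eq_single t]
      · simp [joinBits]
      · intro w _ hw
        simp [Ne.symm hw]
      · simp
    · simp [hs]
  simp only [update_joinBits_qubit]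
  simp only [Matrix.mul_assoc] at hstep ⊢
  rw [Finset.sum_congr rfl fun u _ => congrArg (· * _) (hstep u)]
  simp only [ite_mul, zero_mul, Finset.sum_ite_eq, Finset.mem_univ, if_true, Matrix.of_apply]
  simp only [joinBits, Sum.elim_inr, Sum.elim_inl]
  ring

/-- The Bell circuit takes the `X`-basis pair `|s⟩|s⟩` to `|0⟩` in front and `|s⟩` (in the `X`
basis) at the back. So `½ ∑ (-1)^{st} |t,t⟩⟨s,s|` becomes `(1/√2) |0⟩⟨0| ⊗ H`, which explains both
the projector `f` and the efficiency. -/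
theorem implements_hadamardGadget {n : ℕ} (i : Fin n) :
    Implements (hadamardGadget.rename (wiresAt i 2) (wiresAt_injective i 2))
      ((2 : ℝ) ^ (-1 / 2 : ℝ))
      (prodMat (Function.update 1 i (hadamard * hadamard * hadamard))) := by
  have hη : ((2 : ℝ) ^ (-1 / 2 : ℝ)) = 1 / Real.sqrt 2 := by
    rw [Real.sqrt_eq_rpow, one_div, ← Real.rpow_neg (by norm_num)]
    norm_num
  rw [hadamard_mul_self, Matrix.one_mul, hη]
  refine implements_rename_wiresAt i
    (f := Matrix.diagonal fun x => if x then 0 else 1) preservesAssistant_hadamardGadget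
    (by simp) (by simp) ?_
  have hsum : ∀ g : Bits (Fin 2) → Matrix (Bool × Bool) (Bool × Bool) ℂ,
      ∑ s, g s = ∑ s, ∑ t, g ![s, t] := by
    intro g
    rw [← Equiv.sum_comp (finTwoArrowEquiv Bool).symm, Fintype.sum_prod_type]
    rfl
  rw [hsum]
  simp only [krausOne_hadamardGadget]
  have hc := inv_sqrt_two_sq
  ext ⟨x, x'⟩ ⟨y, y'⟩
  simp only [bellPair, Matrix.mul_apply, Fintype.sum_prod_type,
    Fintype.sum_bool, Matrix.kroneckerMap_apply, Matrix.one_apply, Matrix.diagonal_apply,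
    basisMap, Matrix.of_apply, hadamard, Matrix.add_apply, Matrix.smul_apply, Matrix.map_apply]
  have hcs : star (((1 / Real.sqrt 2 : ℝ) : ℂ)) = ((1 / Real.sqrt 2 : ℝ) : ℂ) := by simp
  generalize (((1 / Real.sqrt 2 : ℝ) : ℂ)) = c at hc hcs
  -- Each entry compares terms of degree seven in `c = 1/√2` (one factor from the Bell circuit,
  -- three from each Kraus operator) with terms of degree three.
  have h3 : c ^ 3 = c / 2 := by rw [pow_succ, hc]; ring
  have h7 : c ^ 7 = c / 8 := by
    linear_combination (c ^ 4 + c ^ 2 / 2 + 1 / 4) * h3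
  have hcs' : (starRingEnd ℂ) c = c := hcs
  cases x <;> cases x' <;> cases y <;> cases y' <;> simp [hcs'] <;> ring_nf <;>
    simp only [h3, h7] <;> ring

end HadamardGadget

/-! ### The gadget for CNOT. -/

section CNOTGadget

variable {n : ℕ}

/-- Conjugation by Hadamard gates exchanges control and target of a CNOT gate. -/
theorem hadamardAll_mul_cnot {ι : Type} [Fintype ι] [DecidableEq ι] {c t : ι} (h : c ≠ t) :
    hadamardAll ι * basisMap (cnotMap c t) = basisMap (cnotMap t c) * hadamardAll ι := by
  ext x y
  rw [mul_basisMap_apply, basisMap_mul_apply (cnotMap_involutive h.symm)]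
  simp only [hadamardAll, Matrix.of_apply]
  have hc : c ∈ Finset.univ.erase t := Finset.mem_erase.2 ⟨h, Finset.mem_univ _⟩
  rw [← Finset.mul_prod_erase _ _ (Finset.mem_univ t), ← Finset.mul_prod_erase _ _ hc,
    ← Finset.mul_prod_erase (a := t) _ _ (Finset.mem_univ t), ← Finset.mul_prod_erase _ _ hc,
    ← mul_assoc, ← mul_assoc]
  congr 1
  · simp only [cnotMap, Function.update_self, Function.update_of_ne h, Function.update_of_ne h.symm,
      hadamard, Matrix.of_apply]
    cases x t <;> cases x c <;> cases y t <;> cases y c <;> simp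
  · refine Finset.prod_congr rfl fun j hj => ?_
    have hjc : j ≠ c := Finset.ne_of_mem_erase hj
    have hjt : j ≠ t := Finset.ne_of_mem_erase (Finset.mem_of_mem_erase hj)
    rw [cnotMap, cnotMap, Function.update_of_ne hjt, Function.update_of_ne hjc]

theorem conjHadamardGate_CNOT {c t : Fin n} (h : c ≠ t) :
    conjHadamardGate (.CNOT c t h) = basisMap (cnotMap t c) := by
  rw [conjHadamardGate, Gate.toMatrix_CNOT, hadamardAll_mul_cnot h, Matrix.mul_assoc,
    hadamardAll_mul_self, Matrix.mul_one]

theorem basisMap_kronecker {α β : Type} [Fintype α] [DecidableEq α] [Fintype β] [DecidableEq β]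
    (σ : α → α) (τ : β → β) : basisMap σ ⊗ₖ basisMap τ = basisMap (Prod.map σ τ) := by
  ext p q
  simp only [basisMap, Matrix.kroneckerMap_apply, Matrix.of_apply, Prod.ext_iff, Prod.map_fst,
    Prod.map_snd, ite_and]
  split_ifs <;> simp

/-- The same reversed CNOT on both registers commutes with the pairwise XOR by linearity; the
Hadamard transform of the front register then exchanges control and target there only. -/
theorem bellCircuit_mul_cnot {c t : Fin n} (h : c ≠ t) :
    bellCircuit n * (basisMap (cnotMap t c) ⊗ₖ basisMap (cnotMap t c)) =
      (basisMap (cnotMap c t) ⊗ₖ basisMap (cnotMap t c)) * bellCircuit n := by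
  have hcomm : (basisMap fun q : Bits (Fin n) × Bits (Fin n) =>
      (q.1, fun i => xor (q.2 i) (q.1 i))) *
      (basisMap (cnotMap t c) ⊗ₖ basisMap (cnotMap t c)) =
      (basisMap (cnotMap t c) ⊗ₖ basisMap (cnotMap t c)) *
      basisMap fun q : Bits (Fin n) × Bits (Fin n) =>
      (q.1, fun i => xor (q.2 i) (q.1 i)) := by
    rw [basisMap_kronecker, basisMap_mul, basisMap_mul]
    congr 1
    ext1 ⟨x, y⟩
    simp only [Function.comp_apply, Prod.map_apply, Prod.mk.injEq, true_and]
    ext i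
    simp only [cnotMap]
    rcases eq_or_ne i c with rfl | hi
    · simp only [Function.update_self]
      cases x i <;> cases y i <;> cases x t <;> cases y t <;> rfl
    · simp only [Function.update_of_ne hi]
  rw [bellCircuit_eq, Matrix.mul_assoc, hcomm, ← Matrix.mul_assoc, ← Matrix.mul_assoc,
    ← Matrix.mul_kronecker_mul, ← Matrix.mul_kronecker_mul, hadamardAll_mul_cnot h.symm,
    Matrix.one_mul, Matrix.mul_one]

/-- No environment is needed: one CNOT on the encoding qubits, irrespective of the assistant, gives
`K = L`. The front register receives a CNOT, which fixes `|0⟩`. -/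
theorem implements_cnotGadget {c t : Fin n} (h : c ≠ t) :
    Implements ([.CNOT (.inr (.inl t)) (.inr (.inl c)) (by simpa using h.symm)] :
      Circuit (Wires n 0)) 1 (basisMap (cnotMap t c)) := by
  rw [Implements, toMatrix_singleton]
  refine ⟨preservesAssistant_CNOT _, basisMap (cnotMap c t), ?_, ?_⟩
  · have hinj : ∀ x : Bits (Fin n), x = cnotMap c t (fun _ => false) ↔ x = fun _ => false := by
      intro x
      have : cnotMap c t (fun _ => false) = fun _ => false := by simp [cnotMap]
      rw [this]
    ext x
    simp [Matrix.mulVec, dotProduct, ketZero, basisMap, hinj]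
  · have hk : ∀ b s, krausOf (Gate.toMatrix (ι := Wires n 0)
        (.CNOT (.inr (.inl t)) (.inr (.inl c)) (by simpa using h.symm))) b s =
          basisMap (cnotMap t c) := by
      intro b s
      ext x y
      have he : cnotMap (ι := Wires n 0) (.inr (.inl t)) (.inr (.inl c))
          (joinBits (b, y) fun _ => false) = joinBits (b, cnotMap t c y) fun _ => false := by
        ext j
        rcases j with _ | j | j
        · rfl
        · rcases eq_or_ne j c with rfl | hj
          · rw [cnotMap, Function.update_self]
            change xor (y j) (y t) = Function.update y j (xor (y j) (y t)) j
            rw [Function.update_self]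
          · rw [cnotMap, Function.update_of_ne (by simpa using hj)]
            change y j = Function.update y c _ j
            rw [Function.update_of_ne hj]
        · rfl
      rw [krausOf, Matrix.of_apply, Gate.toMatrix_CNOT, basisMap, Matrix.of_apply, he,
        Subsingleton.elim s fun _ => false, basisMap, Matrix.of_apply]
      exact if_congr ⟨fun h => funext fun i => congrFun h (.inr (.inl i)), fun h => by rw [h]⟩
        rfl rfl
    have hstar : (basisMap (cnotMap t c)).map star = basisMap (cnotMap t c) := by
      ext x y
      simp only [basisMap, Matrix.map_apply, Matrix.of_apply]
      split_ifs <;> simp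
    simp only [transferMat, hk, Finset.univ_unique, Finset.sum_singleton, hstar]
    rw [bellCircuit_mul_cnot h, Complex.ofReal_one, one_smul]

end CNOTGadget

/-! ### All gates together, and the theorem. -/

theorem diagonal_eq_prodMat {ι : Type} [Fintype ι] [DecidableEq ι] (i : ι) (d : ℂ) :
    (Matrix.diagonal fun z : Bits ι => if z i then d else 1) =
      prodMat (Function.update 1 i (Matrix.diagonal fun b => if b then d else 1)) := by
  ext x y
  rw [prodMat_update_one_apply, Matrix.diagonal_apply, Matrix.diagonal_apply]
  by_cases h : x = y
  · subst h
    simp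
  · rw [if_neg h]
    by_cases h1 : ∀ j, j ≠ i → x j = y j
    · rw [if_pos h1, if_neg]
      exact fun h2 => h (funext fun j => (eq_or_ne j i).elim (fun hj => hj ▸ h2) (h1 j))
    · rw [if_neg h1]

/-- The constant comes from the `T` gadget, the longest: two doubly controlled `Z` circuits of 35
gates, six Hadamard gates, and seven `T` gates for the inverse. -/
theorem exists_implements_gate {n : ℕ} (g : Gate (Fin n)) :
    ∃ (e : ℕ) (W : Circuit (Wires n e)), e ≤ 83 ∧ W.length ≤ 83 ∧
      Implements W (if g.isH then (2 : ℝ) ^ (-1 / 2 : ℝ) else 1) (conjHadamardGate g) := by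
  cases g with
  | H i =>
    refine ⟨2, hadamardGadget.rename (wiresAt i 2) (wiresAt_injective i 2), by norm_num, ?_, ?_⟩
    rotate_left
    · rw [conjHadamardGate, Gate.toMatrix_H, conj_prodMat_update]
      exact implements_hadamardGadget i
    · rw [Circuit.length_rename]
      decide
  | S i =>
    have hP : Circuit.toMatrix (List.replicate 3 (Gate.S (.inr (.inr 0) : Wires 1 1))) =
        Matrix.diagonal fun z => if z (.inr (.inr 0)) then star Complex.I else 1 := by
      rw [toMatrix_replicate (w := Complex.I) rfl, Complex.I_pow_three]
      simp
    refine ⟨1, (phaseGadget (List.replicate 3 (.S (.inr (.inr 0))))).rename (wiresAt i 1)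
      (wiresAt_injective i 1), by norm_num, ?_, ?_⟩
    rotate_left
    · have hg : (Gate.S i).toMatrix = _ := diagonal_eq_prodMat i Complex.I
      rw [conjHadamardGate, hg, conj_prodMat_update]
      exact implements_phaseGadget i hP
    · rw [Circuit.length_rename]
      decide
  | T i =>
    have hstar : eighthRoot ^ 7 = star eighthRoot := by
      have h1 : eighthRoot * star eighthRoot = 1 := by
        rw [Complex.star_def, Complex.mul_conj', eighthRoot, mul_comm,
          Complex.norm_exp_ofReal_mul_I]
        simp
      have h8 : eighthRoot ^ 8 = 1 := by
        rw [show 8 = 4 * 2 by norm_num, pow_mul, eighthRoot_pow_four]; norm_num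
      calc eighthRoot ^ 7 = eighthRoot ^ 7 * (eighthRoot * star eighthRoot) := by rw [h1, mul_one]
        _ = eighthRoot ^ 8 * star eighthRoot := by ring
        _ = star eighthRoot := by rw [h8, one_mul]
    have hP : Circuit.toMatrix (List.replicate 7 (Gate.T (.inr (.inr 0) : Wires 1 1))) =
        Matrix.diagonal fun z => if z (.inr (.inr 0)) then star eighthRoot else 1 := by
      rw [toMatrix_replicate (w := eighthRoot) rfl, hstar]
    refine ⟨1, (phaseGadget (List.replicate 7 (.T (.inr (.inr 0))))).rename (wiresAt i 1)
      (wiresAt_injective i 1), by norm_num, ?_, ?_⟩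
    rotate_left
    · have hg : (Gate.T i).toMatrix = _ := diagonal_eq_prodMat i eighthRoot
      rw [conjHadamardGate, hg, conj_prodMat_update]
      exact implements_phaseGadget i hP
    · rw [Circuit.length_rename]
      decide
  | CNOT c t h =>
    refine ⟨0, [.CNOT (.inr (.inl t)) (.inr (.inl c)) (by simpa using h.symm)], by norm_num, ?_, ?_⟩
    rotate_left
    · rw [conjHadamardGate_CNOT]
      exact implements_cnotGadget h
    · simp

theorem theorem2 :
    -- the channel `C_V`, with gate complexity comparable to that of `U`
    (∃ c : ℕ, ∀ (n : ℕ) (U : Circuit (Fin n)),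
      ∃ (e : ℕ) (W : Circuit (Wires n e)) (C : BlockChannel n),
        e ≤ c * U.length ∧ W.length ≤ c * U.length ∧
        C.IsPurifiedBy W.toMatrix ∧
        C.Realizes ((2 : ℝ) ^ (-(U.hadamardCount : ℝ) / 2)) (conjHadamard U)) ∧
    -- estimation with few queries to such a channel
    (∃ B : ℝ, 0 < B ∧ ∀ (n k e : ℕ) (ε : ℝ), 0 < ε →
      ∀ part : ℂ → ℝ, (part = Complex.re ∨ part = Complex.im) →
        ∃ A : QueryAlgorithm (Wires n e),
          (A.queries : ℝ) ≤ B * ((2 : ℝ) ^ (-((n : ℝ) - (k : ℝ)) / 2) * ε⁻¹) ∧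
          ∀ U : Circuit (Fin n), U.hadamardCount = k →
            ∀ (C : BlockChannel n) (W : Matrix (Bits (Wires n e)) (Bits (Wires n e)) ℂ),
              C.IsPurifiedBy W →
              C.Realizes ((2 : ℝ) ^ (-(k : ℝ) / 2)) (conjHadamard U) →
                2 / 3 ≤ A.successProb W (part (plusZeroAmplitude U)) ε) := by
  refine ⟨⟨83, fun n U => ?_⟩, 48, by norm_num, fun n k e ε hε part hpart => ?_⟩
  · obtain ⟨e, W, he, hl, hW⟩ := exists_implements_of_gates exists_implements_gate U
    obtain ⟨C, hC, hR⟩ := hW.exists_blockChannel (by positivity)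
    exact ⟨e, W, C, he, hl, hC, hR⟩
  · obtain ⟨A, hA, hest⟩ := exists_queryAlgorithm_plusZeroAmplitude n k e hε hpart
    exact ⟨A, hA, fun U _ C W hC hR => hest U C W hC hR⟩
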